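/- Let $\Lambda(X,Y)={}^tXJY$ with $J=\begin{pmatrix}0&I_2\\-I_2&0\end{pmatrix}$ be the standard symplectic form on $\mathbb{R}^4$, $\mathrm{Sp}(4,\mathbb R)$ the group of matrices $A$ with ${}^tAJA=J$, and $\mathcal{S}(4,\mathbb{R})$ the affine symplectic group of the matrices $\begin{pmatrix}1&0\\a&A\end{pmatrix}$, $a\in\mathbb{R}^4$, $A\in \mathrm{Sp}(4,\mathbb{R})$, acting on $\mathbb{R}^4$ by $x\mapsto Ax+a$; let $\mathfrak s(4,\mathbb R)$ be its Lie algebra. Let $I\subset\mathbb R$ be an interval with more than one point. A smooth curve $\gamma:I\to\mathbb{R}^4$ is Lagrangian if $\gamma',\gamma''$ are everywhere linearly independent and $\Lambda(\gamma',\gamma'')=0$. Its symplectic curvatures are $\kappa_i=\Lambda(\gamma^{(i)},\gamma^{(i+1)})$; it is parametrized by symplectic arc-length if $\kappa_2=1$. For constants $\kappa_3,\kappa_4\in\mathbb R$ let $\mathcal C_I(\kappa_3,\kappa_4)$ be the set of Lagrangian curves on $I$, parametrized by symplectic arc-length ($\kappa_1=0$, $\kappa_2=1$), with constant curvatures $\kappa_3,\kappa_4$.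 Two curves on $I$ are called congruent if they differ by an element of $\mathcal S(4,\mathbb R)$. Put $$A=\begin{pmatrix}0&0&0&0&0\\1&0&0&\kappa_3^2-\kappa_4&0\\0&1&0&0&-\kappa_3\\0&0&0&0&-1\\0&0&1&0&0\end{pmatrix}\in\mathfrak s(4,\mathbb R),\qquad \pi(\lambda)=\lambda^4+\kappa_3\lambda^2+\kappa_3^2-\kappa_4 .$$ 1. The characteristic polynomial of $A$ is $\lambda\,\pi(\lambda)$. A curve $\gamma$ on $I$ belongs to $\mathcal C_I(\kappa_3,\kappa_4)$ if and only if there is $B\in\mathcal S(4,\mathbb R)$ such that $(1,\gamma(s))$ is the first column of $Be^{sA}$ for all $s\in I$. 2. Every $\gamma\in\mathcal C_I(\kappa_3,\kappa_4)$ runs along an orbit of a one-parameter subgroup: $\gamma(s)=e^{sX}\star p$ on $I$ for some $X\in\mathfrak s(4,\mathbb R)$, $p\in\mathbb R^4$. 3. Each $(\kappa_3,\kappa_4)\in\mathbb R^2$ belongs to exactly one of the following nine cases. In each case there are parameters $\mu,\nu$ (resp. $\mu$) as indicated such that $\pi$ has the indicated complex roots (with multiplicity) and, on every $I$, $\mathcal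 C_I(\kappa_3,\kappa_4)$ consists exactly of the curves congruent to (the restriction to $I$ of) the indicated curve $\gamma$. * I: $(\kappa_3^2-\kappa_4)(4\kappa_4-3\kappa_3^2)\ne0$. * I.1: $4\kappa_4<3\kappa_3^2$; roots $\pm\mu\pm i\nu$, $\mu,\nu>0$; $$\gamma=\Big(\tfrac{\mu\cos\nu s\,\sinh\mu s}{\mu^2+\nu^2},\ \tfrac{(3\mu^2-\nu^2)\sin\nu s\,\sinh\mu s}{2(\mu^2+\nu^2)^2\mu\nu}+\tfrac{(\mu^2-3\nu^2)\cos\nu s\,\cosh\mu s}{2(\mu^2+\nu^2)^2\nu^2},\ \tfrac{(3\nu^2-\mu^2)\sin\nu s\,\sinh\mu s}{2(\mu^2+\nu^2)^2\mu\nu}+\tfrac{(3\mu^2-\nu^2)\cos\nu s\,\cosh\mu s}{2(\mu^2+\nu^2)^2\mu^2},\ \tfrac{\nu\sin\nu s\,\cosh\mu s}{\mu^2+\nu^2}\Big);$$ if moreover $\mu^2\ne3\nu^2$ and $\nu^2\neq3\mu^2$, one can also take $$\gamma=\Big(\tfrac{(\mu^2-3\nu^2)\mu\cos\nu s\,\sinh\mu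 s}{\mu^2+\nu^2},\ -\tfrac{\sin\nu s\,\sinh\mu s}{2(\mu^2+\nu^2)^2\mu\nu}+\tfrac{(\mu^2-3\nu^2)\cos\nu s\,\cosh\mu s}{2(\nu^2-3\mu^2)(\mu^2+\nu^2)^2\nu^2},\ -\tfrac{\sin\nu s\,\sinh\mu s}{2(\mu^2+\nu^2)^2\mu\nu}+\tfrac{(3\mu^2-\nu^2)\cos\nu s\,\cosh\mu s}{2(\mu^2-3\nu^2)(\mu^2+\nu^2)^2\mu^2},\ \tfrac{(\nu^2-3\mu^2)\nu\sin\nu s\,\cosh\mu s}{\mu^2+\nu^2}\Big).$$ * I.2: $4\kappa_4>3\kappa_3^2$; put $\delta=\sqrt{4\kappa_4-3\kappa_3^2}$. * I.2.a: $\kappa_3<\pm\delta$; roots $\pm\mu,\pm\nu$, $\mu>\nu>0$; with $d=\sqrt{\mu^2-\nu^2}$, $\gamma=\Big(\tfrac{\sinh\nu s}{d\nu^{3/2}},\tfrac{\cosh\mu s}{d\mu^{3/2}},\tfrac{\cosh\nu s}{d\nu^{3/2}},\tfrac{\sinh\mu s}{d\mu^{3/2}}\Big)$. * I.2.b: $\pm\delta<\kappa_3$;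 roots $\pm i\mu,\pm i\nu$, $\mu>\nu>0$; with $d=\sqrt{\mu^2-\nu^2}$, $\gamma=\Big(\tfrac{\sin\nu s}{d\nu^{3/2}},\tfrac{\cos\mu s}{d\mu^{3/2}},\tfrac{\cos\nu s}{d\nu^{3/2}},\tfrac{\sin\mu s}{d\mu^{3/2}}\Big)$; moreover $\kappa_3=\mu^2+\nu^2$, $\kappa_4=\mu^4+\mu^2\nu^2+\nu^4$. * I.2.c: $-\delta<\kappa_3<\delta$; roots $\pm i\mu,\pm\nu$, $\mu,\nu>0$; with $d=\sqrt{\mu^2+\nu^2}$, $\gamma=\Big(-\tfrac{\sinh\nu s}{d\nu^{3/2}},\tfrac{\cos\mu s}{d\mu^{3/2}},\tfrac{\cosh\nu s}{d\nu^{3/2}},\tfrac{\sin\mu s}{d\mu^{3/2}}\Big)$. * II: $\kappa_4=\kappa_3^2$, $\kappa_3\neq0$. * II.1: $\kappa_3<0$; roots $0,0,\pm\mu$, $\mu=\sqrt{-\kappa_3}$; $\gamma=\Big(s,\tfrac{\cosh\mu s}{\mu^{5/2}},\tfrac{s^2}{2\mu^2},\tfrac{\sinh\mu s}{\mu^{5/2}}\Big)$.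 * II.2: $\kappa_3>0$; roots $0,0,\pm i\mu$, $\mu=\sqrt{\kappa_3}$; $\gamma=\Big(s,\tfrac{\cos\mu s}{\mu^{5/2}},-\tfrac{s^2}{2\mu^2},\tfrac{\sin\mu s}{\mu^{5/2}}\Big)$. * III: $4\kappa_4=3\kappa_3^2$, $\kappa_3\ne0$. * III.1: $\kappa_3>0$; double roots $\pm i\mu$, $\mu=\sqrt{\kappa_3/2}$; $\gamma=\Big(\tfrac{s\cos\mu s}{\mu^2},\tfrac{s\sin\mu s}{\mu}+\tfrac{3\cos\mu s}{\mu^2},-\tfrac{\cos\mu s}{2\mu^2},-\tfrac{\sin\mu s}{2\mu^3}\Big)$. * III.2: $\kappa_3<0$; double roots $\pm\mu$, $\mu=\sqrt{-\kappa_3/2}$; $\gamma=\Big(\tfrac{s\cosh\mu s}{\mu^2},\tfrac{s\sinh\mu s}{\mu}-\tfrac{3\cosh\mu s}{\mu^2},-\tfrac{\cosh\mu s}{2\mu^2},\tfrac{\sinh\mu s}{2\mu^3}\Big)$. * IV: $\kappa_3=\kappa_4=0$; all roots $0$; $\gamma=\Big(\tfrac{s}{\sqrt{24}},\tfrac{s^2}{\sqrt{12}},-\tfrac{s^4}{\sqrt{24}},\tfrac{s^3}{\sqrt{12}}\Big)$.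 4. Let $\mathrm T^2\cong \mathrm{SO}(2)\times \mathrm{SO}(2)$ be the group of all $$X(\theta_1,\theta_2)=\begin{pmatrix}1&0&0&0&0\\0&\cos\theta_1&0&-\sin\theta_1&0\\0&0&\cos\theta_2&0&-\sin\theta_2\\0&\sin\theta_1&0&\cos\theta_1&0\\0&0&\sin\theta_2&0&\cos\theta_2\end{pmatrix}.$$ It is a maximal Abelian subgroup of $\mathcal S(4,\mathbb R)$. For $\mu>\nu>0$ let $p_{\mu,\nu}=\big(0,(\mu^3(\mu^2-\nu^2))^{-1/2},(\nu^3(\mu^2-\nu^2))^{-1/2},0\big)$ and let $\mathrm T^2_{\mu,\nu}$ be the orbit of $p_{\mu,\nu}$ under $\mathrm T^2$. The curve $\gamma$ displayed in I.2.b is $s\mapsto e^{sX_{\mu,\nu}}\star p_{\mu,\nu}$, where $X_{\mu,\nu}\in\mathfrak s(4,\mathbb R)$ is the generator of the linear flow $x_1'=\nu x_3$, $x_2'=-\mu x_4$, $x_3'=-\nu x_1$, $x_4'=\mu x_2$. For every curve $\gamma\in\mathcal C_I(\kappa_3,\kappa_4)$ of type I.2.b there is $g\in\mathcal S(4,\mathbb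 R)$ such that $g\star\mathrm T^2_{\mu,\nu}$ is a homogeneous Lagrangian torus (an embedded Lagrangian torus that is an orbit of a subgroup of $\mathcal S(4,\mathbb R)$), the trajectory $\gamma(I)$ lies on it, and $\gamma$ follows the linear flow $\gamma(s)=g\star X(-\nu s,\mu s)\star p_{\mu,\nu}$. If $I=\mathbb R$, then $\gamma$ is either a simple closed curve or dense in this torus. -/

import Mathlib

open scoped ContDiff
open Matrix

/-! ### The affine symplectic group of `ℝ⁴` -/

/-- The matrix `J` of the standard symplectic form on `ℝ⁴`. -/
def sympJ : Matrix (Fin 4) (Fin 4) ℝ :=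
  !![0, 0, 1, 0;
     0, 0, 0, 1;
     -1, 0, 0, 0;
     0, -1, 0, 0]

/-- The standard symplectic form `Λ(X, Y) = ᵗX J Y`. -/
def sympForm (x y : Fin 4 → ℝ) : ℝ := x ⬝ᵥ (sympJ *ᵥ y)

/-- The linear symplectic group `Sp(4, ℝ)`. -/
def symplecticGroup4 : Subgroup (GL (Fin 4) ℝ) where
  carrier := {A | (A : Matrix (Fin 4) (Fin 4) ℝ)ᵀ * sympJ * A = sympJ}
  one_mem' := by simp
  mul_mem' := by
    intro A B hA hB
    simp only [Set.mem_ofPred_eq] at hA hB ⊢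
    rw [Units.val_mul, transpose_mul]
    calc (B : Matrix (Fin 4) (Fin 4) ℝ)ᵀ * (A : Matrix (Fin 4) (Fin 4) ℝ)ᵀ * sympJ * (A * B)
        = (B : Matrix (Fin 4) (Fin 4) ℝ)ᵀ *
            ((A : Matrix (Fin 4) (Fin 4) ℝ)ᵀ * sympJ * A) * B := by
          simp only [Matrix.mul_assoc]
      _ = sympJ := by rw [hA, hB]
  inv_mem' := by
    intro A hA
    simp only [Set.mem_ofPred_eq] at hA ⊢
    have h1 : (A : Matrix (Fin 4) (Fin 4) ℝ) * (A⁻¹ : GL (Fin 4) ℝ) = 1 := A.mul_inv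
    have h2 : ((A⁻¹ : GL (Fin 4) ℝ) : Matrix (Fin 4) (Fin 4) ℝ)ᵀ *
        (A : Matrix (Fin 4) (Fin 4) ℝ)ᵀ = 1 := by
      rw [← transpose_mul, h1, transpose_one]
    generalize ((A⁻¹ : GL (Fin 4) ℝ) : Matrix (Fin 4) (Fin 4) ℝ) = B at h1 h2 ⊢
    calc Bᵀ * sympJ * B
        = Bᵀ * ((A : Matrix (Fin 4) (Fin 4) ℝ)ᵀ * sympJ * A) * B := by rw [hA]
      _ = (Bᵀ * (A : Matrix (Fin 4) (Fin 4) ℝ)ᵀ) * sympJ *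
            ((A : Matrix (Fin 4) (Fin 4) ℝ) * B) := by simp only [Matrix.mul_assoc]
      _ = sympJ := by rw [h1, h2, Matrix.one_mul, Matrix.mul_one]

/-- The `5 × 5` block matrix with rows `(c, 0)` and `(a, A)`. -/
def blockMatrix (c : ℝ) (a : Fin 4 → ℝ) (A : Matrix (Fin 4) (Fin 4) ℝ) :
    Matrix (Fin 5) (Fin 5) ℝ :=
  Matrix.of (Fin.cons (Fin.cons c 0) (fun i => Fin.cons (a i) (A i)))

theorem blockMatrix_one : blockMatrix 1 0 1 = 1 := by
  ext i j
  refine Fin.cases ?_ (fun i => ?_) i <;> refine Fin.cases ?_ (fun j => ?_) j <;>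
    simp [blockMatrix, Matrix.one_apply, Fin.succ_ne_zero, (Fin.succ_ne_zero _).symm]

theorem blockMatrix_mul (a b : Fin 4 → ℝ) (A B : Matrix (Fin 4) (Fin 4) ℝ) :
    blockMatrix 1 a A * blockMatrix 1 b B = blockMatrix 1 (A *ᵥ b + a) (A * B) := by
  ext i j
  refine Fin.cases ?_ (fun i => ?_) i <;> refine Fin.cases ?_ (fun j => ?_) j <;>
    simp [blockMatrix, Matrix.mul_apply, Fin.sum_univ_succ, Matrix.mulVec, dotProduct, add_comm]

/-- The affine symplectic group `𝒮(4, ℝ)` in its representation by `5 × 5` matrices. -/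
def affineSymplecticGroup : Subgroup (GL (Fin 5) ℝ) where
  carrier := {g | ∃ a : Fin 4 → ℝ, ∃ A ∈ symplecticGroup4,
    (g : Matrix (Fin 5) (Fin 5) ℝ) = blockMatrix 1 a (A : Matrix (Fin 4) (Fin 4) ℝ)}
  one_mem' := ⟨0, 1, one_mem _, by simp [blockMatrix_one]⟩
  mul_mem' := by
    rintro g h ⟨a, A, hA, hg⟩ ⟨b, B, hB, hh⟩
    exact ⟨_, A * B, mul_mem hA hB, by
      rw [Units.val_mul, hg, hh, blockMatrix_mul, Units.val_mul]⟩
  inv_mem' := by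
    rintro g ⟨a, A, hA, hg⟩
    refine ⟨-(((A⁻¹ : GL (Fin 4) ℝ) : Matrix (Fin 4) (Fin 4) ℝ) *ᵥ a), A⁻¹, inv_mem hA, ?_⟩
    apply Units.inv_eq_of_mul_eq_one_right
    rw [hg, blockMatrix_mul, Matrix.mulVec_neg, Matrix.mulVec_mulVec, A.mul_inv,
      Matrix.one_mulVec, neg_add_cancel, blockMatrix_one]

/-- The action `(a, A) ⋆ x = A x + a` of `5 × 5` matrices with rows `(1, 0)`, `(a, A)` on `ℝ⁴`. -/
def affineAct (M : Matrix (Fin 5) (Fin 5) ℝ) (x : Fin 4 → ℝ) : Fin 4 → ℝ :=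
  fun i => (M *ᵥ (Fin.cons 1 x : Fin 5 → ℝ)) i.succ

/-- The point of `ℝ⁴` in the first column `(1, p)` of a `5 × 5` matrix. -/
def firstColumn (M : Matrix (Fin 5) (Fin 5) ℝ) : Fin 4 → ℝ := fun i => M i.succ 0

/-- The Lie algebra `𝔰(4, ℝ)` of the affine symplectic group. -/
def affineSymplecticAlgebra : Set (Matrix (Fin 5) (Fin 5) ℝ) :=
  {X | ∃ a : Fin 4 → ℝ, ∃ A : Matrix (Fin 4) (Fin 4) ℝ,
    Aᵀ * sympJ + sympJ * A = 0 ∧ X = blockMatrix 0 a A}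

/-! ### Lagrangian curves and their symplectic curvatures -/

/-- The `i`-th symplectic curvature `κᵢ = Λ(γ⁽ⁱ⁾, γ⁽ⁱ⁺¹⁾)` of a curve `γ` on an interval `I`. -/
noncomputable def sympCurvature (i : ℕ) (γ : ℝ → Fin 4 → ℝ) (I : Set ℝ) (t : ℝ) : ℝ :=
  sympForm (iteratedDerivWithin i γ I t) (iteratedDerivWithin (i + 1) γ I t)

/-- `γ : I → ℝ⁴` is a smooth Lagrangian curve. -/
structure IsLagrangianCurve (γ : ℝ → Fin 4 → ℝ) (I : Set ℝ) : Prop where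
  smooth : ContDiffOn ℝ ∞ γ I
  linearIndependent : ∀ t ∈ I, LinearIndependent ℝ
    ![iteratedDerivWithin 1 γ I t, iteratedDerivWithin 2 γ I t]
  isotropic : ∀ t ∈ I, sympCurvature 1 γ I t = 0

/-- `γ : I → ℝ⁴` is a Lagrangian curve that is parametrized by the symplectic arc-length
(`κ₂ = Λ(γ'', γ''') = 1`) and has the constant symplectic curvatures `κ₃`, `κ₄`. -/
structure HasConstantCurvatures (γ : ℝ → Fin 4 → ℝ) (I : Set ℝ) (κ₃ κ₄ : ℝ) : Prop where
  lagrangian : IsLagrangianCurve γ I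
  arcLength : ∀ t ∈ I, sympCurvature 2 γ I t = 1
  curvature_three : ∀ t ∈ I, sympCurvature 3 γ I t = κ₃
  curvature_four : ∀ t ∈ I, sympCurvature 4 γ I t = κ₄

/-- The domains of curves: intervals with more than one point (open or not, bounded or not). -/
def IsCurveDomain (I : Set ℝ) : Prop := I.OrdConnected ∧ I.Nontrivial

/-- On `I`, the curve `γ` is the image of `γ₀` under an affine symplectic transformation. -/
def CongruentOn (I : Set ℝ) (γ γ₀ : ℝ → Fin 4 → ℝ) : Prop :=
  ∃ g ∈ affineSymplecticGroup, ∀ s ∈ I, γ s = affineAct g (γ₀ s)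

/-- On each interval, the Lagrangian curves parametrized by arc-length with constant curvatures
`κ₃`, `κ₄` are exactly the images of `γ₀` under affine symplectic transformations. -/
def IsNormalForm (κ₃ κ₄ : ℝ) (γ₀ : ℝ → Fin 4 → ℝ) : Prop :=
  ∀ (I : Set ℝ) (γ : ℝ → Fin 4 → ℝ), IsCurveDomain I →
    (HasConstantCurvatures γ I κ₃ κ₄ ↔ CongruentOn I γ γ₀)

/-- The matrix of the Serret-Frenet equations for constant curvatures. -/
def frenetMatrix (κ₃ κ₄ : ℝ) : Matrix (Fin 5) (Fin 5) ℝ :=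
  !![0, 0, 0, 0, 0;
     1, 0, 0, κ₃ ^ 2 - κ₄, 0;
     0, 1, 0, 0, -κ₃;
     0, 0, 0, 0, -1;
     0, 0, 1, 0, 0]

/-- The polynomial `π(λ) = λ⁴ + κ₃ λ² + κ₃² - κ₄`. -/
noncomputable def quarticPoly (κ₃ κ₄ : ℝ) : Polynomial ℝ :=
  Polynomial.X ^ 4 + Polynomial.C κ₃ * Polynomial.X ^ 2 + Polynomial.C (κ₃ ^ 2 - κ₄)

/-- The complex roots of `π`, with multiplicities. -/
noncomputable def quarticRoots (κ₃ κ₄ : ℝ) : Multiset ℂ :=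
  ((quarticPoly κ₃ κ₄).map (algebraMap ℝ ℂ)).roots

/-! ### The cases of the classification -/

inductive CurveType
  | I1 | I2a | I2b | I2c | II1 | II2 | III1 | III2 | IV

/-- The conditions on the curvatures that define the nine cases. -/
def CurveType.Condition : CurveType → ℝ → ℝ → Prop
  | .I1, κ₃, κ₄ => (κ₃ ^ 2 - κ₄) * (4 * κ₄ - 3 * κ₃ ^ 2) ≠ 0 ∧ 4 * κ₄ < 3 * κ₃ ^ 2
  | .I2a, κ₃, κ₄ => (κ₃ ^ 2 - κ₄) * (4 * κ₄ - 3 * κ₃ ^ 2) ≠ 0 ∧ 3 * κ₃ ^ 2 < 4 * κ₄ ∧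
      κ₃ < √(4 * κ₄ - 3 * κ₃ ^ 2) ∧ κ₃ < -√(4 * κ₄ - 3 * κ₃ ^ 2)
  | .I2b, κ₃, κ₄ => (κ₃ ^ 2 - κ₄) * (4 * κ₄ - 3 * κ₃ ^ 2) ≠ 0 ∧ 3 * κ₃ ^ 2 < 4 * κ₄ ∧
      √(4 * κ₄ - 3 * κ₃ ^ 2) < κ₃ ∧ -√(4 * κ₄ - 3 * κ₃ ^ 2) < κ₃
  | .I2c, κ₃, κ₄ => (κ₃ ^ 2 - κ₄) * (4 * κ₄ - 3 * κ₃ ^ 2) ≠ 0 ∧ 3 * κ₃ ^ 2 < 4 * κ₄ ∧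
      -√(4 * κ₄ - 3 * κ₃ ^ 2) < κ₃ ∧ κ₃ < √(4 * κ₄ - 3 * κ₃ ^ 2)
  | .II1, κ₃, κ₄ => κ₄ = κ₃ ^ 2 ∧ κ₃ < 0
  | .II2, κ₃, κ₄ => κ₄ = κ₃ ^ 2 ∧ 0 < κ₃
  | .III1, κ₃, κ₄ => 4 * κ₄ = 3 * κ₃ ^ 2 ∧ 0 < κ₃
  | .III2, κ₃, κ₄ => 4 * κ₄ = 3 * κ₃ ^ 2 ∧ κ₃ < 0
  | .IV, κ₃, κ₄ => κ₃ = 0 ∧ κ₄ = 0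

section NormalForms

open Real

/-- Case I.1, defined for all `μ, ν > 0` with `μ² ≠ 3ν²` and `ν² ≠ 3μ²`. -/
noncomputable def curveI1 (μ ν s : ℝ) : Fin 4 → ℝ :=
  ![(μ ^ 2 - 3 * ν ^ 2) * μ * cos (ν * s) * sinh (μ * s) / (μ ^ 2 + ν ^ 2),
    -(1 / 2) * (sin (ν * s) * sinh (μ * s) / ((μ ^ 2 + ν ^ 2) ^ 2 * μ * ν))
      + 1 / 2 * ((μ ^ 2 - 3 * ν ^ 2) * cos (ν * s) * cosh (μ * s)
          / ((ν ^ 2 - 3 * μ ^ 2) * (μ ^ 2 + ν ^ 2) ^ 2 * ν ^ 2)),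
    -(1 / 2) * (sin (ν * s) * sinh (μ * s) / ((μ ^ 2 + ν ^ 2) ^ 2 * μ * ν))
      + 1 / 2 * ((3 * μ ^ 2 - ν ^ 2) * cos (ν * s) * cosh (μ * s)
          / ((μ ^ 2 - 3 * ν ^ 2) * (μ ^ 2 + ν ^ 2) ^ 2 * μ ^ 2)),
    (ν ^ 2 - 3 * μ ^ 2) * ν * sin (ν * s) * cosh (μ * s) / (μ ^ 2 + ν ^ 2)]

/-- Case I.1 without excluded parameters: where both are defined, this is the image of
`curveI1 μ ν` under the linear symplectic map `diag(1/a, b, a, 1/b)` with `a = μ² - 3ν²`,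
`b = ν² - 3μ²`. -/
noncomputable def curveI1' (μ ν s : ℝ) : Fin 4 → ℝ :=
  ![μ * cos (ν * s) * sinh (μ * s) / (μ ^ 2 + ν ^ 2),
    (3 * μ ^ 2 - ν ^ 2) * sin (ν * s) * sinh (μ * s) / (2 * (μ ^ 2 + ν ^ 2) ^ 2 * μ * ν)
      + (μ ^ 2 - 3 * ν ^ 2) * cos (ν * s) * cosh (μ * s) / (2 * (μ ^ 2 + ν ^ 2) ^ 2 * ν ^ 2),
    (3 * ν ^ 2 - μ ^ 2) * sin (ν * s) * sinh (μ * s) / (2 * (μ ^ 2 + ν ^ 2) ^ 2 * μ * ν)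
      + (3 * μ ^ 2 - ν ^ 2) * cos (ν * s) * cosh (μ * s) / (2 * (μ ^ 2 + ν ^ 2) ^ 2 * μ ^ 2),
    ν * sin (ν * s) * cosh (μ * s) / (μ ^ 2 + ν ^ 2)]

noncomputable def curveI2a (μ ν s : ℝ) : Fin 4 → ℝ :=
  ![sinh (ν * s) / (√(μ ^ 2 - ν ^ 2) * ν ^ (3 / 2 : ℝ)),
    cosh (μ * s) / (√(μ ^ 2 - ν ^ 2) * μ ^ (3 / 2 : ℝ)),
    cosh (ν * s) / (√(μ ^ 2 - ν ^ 2) * ν ^ (3 / 2 : ℝ)),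
    sinh (μ * s) / (√(μ ^ 2 - ν ^ 2) * μ ^ (3 / 2 : ℝ))]

noncomputable def curveI2b (μ ν s : ℝ) : Fin 4 → ℝ :=
  ![sin (ν * s) / (√(μ ^ 2 - ν ^ 2) * ν ^ (3 / 2 : ℝ)),
    cos (μ * s) / (√(μ ^ 2 - ν ^ 2) * μ ^ (3 / 2 : ℝ)),
    cos (ν * s) / (√(μ ^ 2 - ν ^ 2) * ν ^ (3 / 2 : ℝ)),
    sin (μ * s) / (√(μ ^ 2 - ν ^ 2) * μ ^ (3 / 2 : ℝ))]

noncomputable def curveI2c (μ ν s : ℝ) : Fin 4 → ℝ :=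
  ![-(sinh (ν * s) / (√(μ ^ 2 + ν ^ 2) * ν ^ (3 / 2 : ℝ))),
    cos (μ * s) / (√(μ ^ 2 + ν ^ 2) * μ ^ (3 / 2 : ℝ)),
    cosh (ν * s) / (√(μ ^ 2 + ν ^ 2) * ν ^ (3 / 2 : ℝ)),
    sin (μ * s) / (√(μ ^ 2 + ν ^ 2) * μ ^ (3 / 2 : ℝ))]

noncomputable def curveII1 (μ s : ℝ) : Fin 4 → ℝ :=
  ![s, cosh (μ * s) / μ ^ (5 / 2 : ℝ), s ^ 2 / (2 * μ ^ 2), sinh (μ * s) / μ ^ (5 / 2 : ℝ)]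

noncomputable def curveII2 (μ s : ℝ) : Fin 4 → ℝ :=
  ![s, cos (μ * s) / μ ^ (5 / 2 : ℝ), -(s ^ 2 / (2 * μ ^ 2)), sin (μ * s) / μ ^ (5 / 2 : ℝ)]

noncomputable def curveIII1 (μ s : ℝ) : Fin 4 → ℝ :=
  ![s * cos (μ * s) / μ ^ 2,
    s * sin (μ * s) / μ + 3 * cos (μ * s) / μ ^ 2,
    -(1 / 2) * (cos (μ * s) / μ ^ 2),
    -(1 / 2) * (sin (μ * s) / μ ^ 3)]

noncomputable def curveIII2 (μ s : ℝ) : Fin 4 → ℝ :=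
  ![s * cosh (μ * s) / μ ^ 2,
    s * sinh (μ * s) / μ - 3 * cosh (μ * s) / μ ^ 2,
    -(1 / 2) * (cosh (μ * s) / μ ^ 2),
    1 / 2 * (sinh (μ * s) / μ ^ 3)]

noncomputable def curveIV (s : ℝ) : Fin 4 → ℝ :=
  ![s / √24, s ^ 2 / √12, -(s ^ 4 / √24), s ^ 3 / √12]

end NormalForms

/-! ### Orbits and homogeneous Lagrangian tori -/

/-- On `I`, the curve `γ` runs along the orbit `s ↦ exp(sX) ⋆ p` of the one-parameter subgroup of
the affine symplectic group generated by some `X ∈ 𝔰(4, ℝ)`. -/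
def IsOrbitOfOneParameterSubgroup (γ : ℝ → Fin 4 → ℝ) (I : Set ℝ) : Prop :=
  ∃ X ∈ affineSymplecticAlgebra, ∃ φ : Multiplicative ℝ →* affineSymplecticGroup,
    (∀ t : ℝ, ((φ (Multiplicative.ofAdd t) : GL (Fin 5) ℝ) : Matrix (Fin 5) (Fin 5) ℝ) =
      NormedSpace.exp (t • X)) ∧
    ∃ p : Fin 4 → ℝ, ∀ s ∈ I,
      γ s = affineAct ((φ (Multiplicative.ofAdd s) : GL (Fin 5) ℝ) : Matrix (Fin 5) (Fin 5) ℝ) p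

/-- `S` is an embedded Lagrangian torus in `ℝ⁴`: the image of an injective Lagrangian immersion
of `ℝ²/(2πℤ)²`. -/
def IsLagrangianTorus (S : Set (Fin 4 → ℝ)) : Prop :=
  ∃ f : ℝ × ℝ → Fin 4 → ℝ, ContDiff ℝ ∞ f ∧
    (∀ x y, f x = f y ↔ ∃ m n : ℤ, x = y + (2 * Real.pi * m, 2 * Real.pi * n)) ∧
    (∀ x, Function.Injective (fderiv ℝ f x)) ∧
    (∀ x u v, sympForm (fderiv ℝ f x u) (fderiv ℝ f x v) = 0) ∧
    Set.range f = S

/-- `S` is the orbit of a point under the subgroup `H` of the affine symplectic group. -/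
def IsOrbitOf (H : Subgroup (GL (Fin 5) ℝ)) (S : Set (Fin 4 → ℝ)) : Prop :=
  ∃ p : Fin 4 → ℝ, S = {x | ∃ h ∈ H, x = affineAct h p}

/-- A Lagrangian torus that is an orbit of a subgroup of the affine symplectic group. -/
def IsHomogeneousLagrangianTorus (S : Set (Fin 4 → ℝ)) : Prop :=
  IsLagrangianTorus S ∧ ∃ H ≤ affineSymplecticGroup, IsOrbitOf H S

/-- The matrix `X(θ₁, θ₂)`. -/
noncomputable def torusMatrix (θ₁ θ₂ : ℝ) : Matrix (Fin 5) (Fin 5) ℝ :=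
  !![1, 0, 0, 0, 0;
     0, Real.cos θ₁, 0, -Real.sin θ₁, 0;
     0, 0, Real.cos θ₂, 0, -Real.sin θ₂;
     0, Real.sin θ₁, 0, Real.cos θ₁, 0;
     0, 0, Real.sin θ₂, 0, Real.cos θ₂]

theorem torusMatrix_mul (a b c d : ℝ) :
    torusMatrix a b * torusMatrix c d = torusMatrix (a + c) (b + d) := by
  ext i j
  fin_cases i <;> fin_cases j <;>
    simp [torusMatrix, Matrix.mul_apply, Fin.sum_univ_succ, Real.cos_add, Real.sin_add] <;> ring

theorem torusMatrix_zero : torusMatrix 0 0 = 1 := by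
  ext i j
  fin_cases i <;> fin_cases j <;> simp [torusMatrix]

/-- The group `𝕋² ≅ SO(2) × SO(2)` of all matrices `X(θ₁, θ₂)`. -/
def torusSubgroup : Subgroup (GL (Fin 5) ℝ) where
  carrier := {g | ∃ θ₁ θ₂ : ℝ, (g : Matrix (Fin 5) (Fin 5) ℝ) = torusMatrix θ₁ θ₂}
  one_mem' := ⟨0, 0, by simp [torusMatrix_zero]⟩
  mul_mem' := by
    rintro g h ⟨a, b, hg⟩ ⟨c, d, hh⟩
    exact ⟨a + c, b + d, by rw [Units.val_mul, hg, hh, torusMatrix_mul]⟩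
  inv_mem' := by
    rintro g ⟨a, b, hg⟩
    refine ⟨-a, -b, Units.inv_eq_of_mul_eq_one_right ?_⟩
    rw [hg, torusMatrix_mul, add_neg_cancel, add_neg_cancel, torusMatrix_zero]

/-- The point `p_{μ,ν}`. -/
noncomputable def torusPoint (μ ν : ℝ) : Fin 4 → ℝ :=
  ![0, (μ ^ 3 * (μ ^ 2 - ν ^ 2)) ^ (-1 / 2 : ℝ), (ν ^ 3 * (μ ^ 2 - ν ^ 2)) ^ (-1 / 2 : ℝ), 0]

/-- The torus `𝕋²_{μ,ν}`: the orbit of `p_{μ,ν}` under `𝕋²`. -/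
def torusOrbit (μ ν : ℝ) : Set (Fin 4 → ℝ) :=
  {x | ∃ h ∈ torusSubgroup, x = affineAct h (torusPoint μ ν)}

/-- The generator `μ (C²₂ - B²₂) + ν (B¹₁ - C¹₁)` of the curves of type I.2.b. -/
def torusGenerator (μ ν : ℝ) : Matrix (Fin 5) (Fin 5) ℝ :=
  !![0, 0, 0, 0, 0;
     0, 0, 0, ν, 0;
     0, 0, 0, 0, -μ;
     0, -ν, 0, 0, 0;
     0, 0, μ, 0, 0]

/-! Write `Λ` for the symplectic form. Differentiating the relations `Λ(γ', γ'') = 0` and `Λ(γ'',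
γ''') = 1` determines all products of `γ', γ'', γ''', γ''''` in terms of `κ₃`. These four vectors
therefore form a basis with constant Gram matrix, and `γ', γ'', -κ₃γ'' - γ'''', γ'''` is a
symplectic frame. The products of `γ⁽⁵⁾` with this basis are constant too, which gives the linear
equation `γ⁽⁵⁾ = -κ₃γ''' - (κ₃² - κ₄)γ'` (`HasConstantCurvatures.exists_jet`), with characteristic
polynomial `λ π(λ)`.

Together with the point `γ` the frame is a curve `F` in the affine symplectic group. The fifth-order
equation becomes `F' = F A` (`IsFrenetChain.hasDerivWithinAt_frame`), so `F(s) = B exp(sA)`. Since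
`A` lies in the Lie algebra, `B exp(sA)` stays in the group for every `B` in it, and its columns
return the jet of a curve with the prescribed curvatures; this gives `hasConstantCurvatures_iff`.
Conjugating, `B exp(sA) = exp(s B A B⁻¹) B`, which exhibits the curve as an orbit.

Hence curves with equal constant curvatures are congruent, and a displayed curve is a normal form as
soon as it solves the equation and its jet at `0` has the right products
(`IsFrenetChain.isNormalForm`). All displayed curves are `C φ` with `φ' = N φ`, so
`isNormalForm_of_linear` reduces the check to finite matrix identities. The cases come from `π`
being quadratic in `λ²` with discriminant `4κ₄ - 3κ₃²`.

In case I.2.b the curve is a linear flow with angular velocities `-ν, μ` on a product of circles in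
two `Λ`-orthogonal planes. Such a torus is Lagrangian, and the flow is periodic or dense according
as `μ / ν` is rational or not. -/

/-! ### Linear algebra of the symplectic form and of the affine group -/

theorem sympForm_eq (x y : Fin 4 → ℝ) :
    sympForm x y = x 0 * y 2 + x 1 * y 3 - x 2 * y 0 - x 3 * y 1 := by
  simp [sympForm, sympJ, Matrix.mulVec, dotProduct, Fin.sum_univ_four]
  ring

theorem sympForm_swap (x y : Fin 4 → ℝ) : sympForm x y = -sympForm y x := by
  simp only [sympForm_eq]; ring

theorem sympJ_mul_self : sympJ * sympJ = -1 := by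
  ext i j
  fin_cases i <;> fin_cases j <;> simp [sympJ, Matrix.mul_apply, Fin.sum_univ_four]

theorem mul_left_inverse_of_symplectic {A : Matrix (Fin 4) (Fin 4) ℝ}
    (h : Aᵀ * sympJ * A = sympJ) : -(sympJ * Aᵀ * sympJ) * A = 1 := by
  rw [Matrix.neg_mul, Matrix.mul_assoc, Matrix.mul_assoc, ← Matrix.mul_assoc Aᵀ, h,
    sympJ_mul_self, neg_neg]

/-- The hypothesis exhibits `-J ᵗA J` as a right inverse of `A`; for square matrices it is also a
left inverse, which is the transposed relation. -/
theorem symplectic_of_transpose {A : Matrix (Fin 4) (Fin 4) ℝ}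
    (h : A * sympJ * Aᵀ = sympJ) : Aᵀ * sympJ * A = sympJ := by
  have h1 : A * -(sympJ * Aᵀ * sympJ) = 1 := by
    rw [Matrix.mul_neg, ← Matrix.mul_assoc, ← Matrix.mul_assoc, h, sympJ_mul_self, neg_neg]
  have h2 := mul_eq_one_comm.1 h1
  calc Aᵀ * sympJ * A = -(sympJ * sympJ) * (Aᵀ * sympJ * A) := by
        rw [sympJ_mul_self, neg_neg, Matrix.one_mul]
    _ = sympJ * (-(sympJ * Aᵀ * sympJ) * A) := by
        simp only [Matrix.neg_mul, Matrix.mul_neg, Matrix.mul_assoc]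
    _ = sympJ := by rw [h2, Matrix.mul_one]

theorem exists_affineSymplectic (a : Fin 4 → ℝ) {A : Matrix (Fin 4) (Fin 4) ℝ}
    (h : Aᵀ * sympJ * A = sympJ) :
    ∃ B ∈ affineSymplecticGroup, (B : Matrix (Fin 5) (Fin 5) ℝ) = blockMatrix 1 a A := by
  have h1 := mul_left_inverse_of_symplectic h
  have h2 := mul_eq_one_comm.1 h1
  generalize -(sympJ * Aᵀ * sympJ) = C at h1 h2
  have h3 : blockMatrix 1 a A * blockMatrix 1 (-(C *ᵥ a)) C = 1 := by
    rw [blockMatrix_mul, Matrix.mulVec_neg, Matrix.mulVec_mulVec, h2, Matrix.one_mulVec,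
      neg_add_cancel, blockMatrix_one]
  exact ⟨⟨blockMatrix 1 a A, blockMatrix 1 (-(C *ᵥ a)) C, h3, mul_eq_one_comm.1 h3⟩,
    ⟨a, ⟨A, C, h2, h1⟩, h, rfl⟩, rfl⟩

/-- A matrix with first row `(1, 0)` is a block matrix. -/
theorem eq_blockMatrix {M : Matrix (Fin 5) (Fin 5) ℝ} (h : ∀ j, M 0 j = (1 : Matrix (Fin 5) (Fin 5) ℝ) 0 j) :
    M = blockMatrix 1 (fun i => M i.succ 0) (of fun i j => M i.succ j.succ) := by
  ext i j
  refine Fin.cases ?_ (fun i => ?_) i <;> refine Fin.cases ?_ (fun j => ?_) j <;>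
    simp [blockMatrix, h, (Fin.succ_ne_zero _).symm]

/-- With `K = diag(0, J)`, the product `M K ᵗM` does not see the translation part of `M`, whereas
`ᵗM K M` would. So the group is cut out by the first row `(1, 0)` and `M K ᵗM = K`, conditions that
are easy to propagate along `exp(sX)`. -/
theorem blockMatrix_mul_form_mul_transpose (c : ℝ) (a : Fin 4 → ℝ)
    (A : Matrix (Fin 4) (Fin 4) ℝ) :
    blockMatrix c a A * blockMatrix 0 0 sympJ * (blockMatrix c a A)ᵀ =
      blockMatrix 0 0 (A * sympJ * Aᵀ) := by
  ext i j
  refine Fin.cases ?_ (fun i => ?_) i <;> refine Fin.cases ?_ (fun j => ?_) j <;>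
    simp [blockMatrix, Matrix.mul_apply, Fin.sum_univ_succ]

theorem blockMatrix_mul_form_add (a : Fin 4 → ℝ) {A : Matrix (Fin 4) (Fin 4) ℝ}
    (h : Aᵀ * sympJ + sympJ * A = 0) :
    blockMatrix 0 a A * blockMatrix 0 0 sympJ +
      blockMatrix 0 0 sympJ * (blockMatrix 0 a A)ᵀ = 0 := by
  have h1 : A * sympJ + sympJ * Aᵀ = 0 := by
    have h2 : sympJ * (Aᵀ * sympJ + sympJ * A) * sympJ = 0 := by simp [h]
    have h3 : sympJ * (Aᵀ * sympJ + sympJ * A) * sympJ =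
        sympJ * Aᵀ * (sympJ * sympJ) + (sympJ * sympJ) * (A * sympJ) := by
      simp only [Matrix.mul_add, Matrix.add_mul, Matrix.mul_assoc]
    rw [h3, sympJ_mul_self, Matrix.mul_neg, Matrix.neg_mul, Matrix.mul_one, Matrix.one_mul,
      ← neg_add, neg_eq_zero] at h2
    rw [add_comm, h2]
  ext i j
  have h4 : ∀ i j, (A * sympJ + sympJ * Aᵀ) i j = 0 := fun i j => by rw [h1]; rfl
  refine Fin.cases ?_ (fun i => ?_) i <;> refine Fin.cases ?_ (fun j => ?_) j
  · simp [blockMatrix, Matrix.mul_apply, Fin.sum_univ_succ]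
  · simp [blockMatrix, Matrix.mul_apply, Fin.sum_univ_succ]
  · simp [blockMatrix, Matrix.mul_apply, Fin.sum_univ_succ]
  · rw [Matrix.zero_apply, ← h4 i j]
    simp [blockMatrix, Matrix.mul_apply, Fin.sum_univ_succ]

theorem exists_affineSymplectic_of_form {M : Matrix (Fin 5) (Fin 5) ℝ}
    (h : ∀ j, M 0 j = (1 : Matrix (Fin 5) (Fin 5) ℝ) 0 j)
    (h' : M * blockMatrix 0 0 sympJ * Mᵀ = blockMatrix 0 0 sympJ) :
    ∃ B ∈ affineSymplecticGroup, (B : Matrix (Fin 5) (Fin 5) ℝ) = M := by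
  rw [eq_blockMatrix h, blockMatrix_mul_form_mul_transpose] at h'
  obtain ⟨B, hB, hBM⟩ := exists_affineSymplectic (fun i => M i.succ 0)
    (symplectic_of_transpose (A := of fun i j => M i.succ j.succ) (by
      ext i j
      simpa [blockMatrix] using congrFun (congrFun h' i.succ) j.succ))
  exact ⟨B, hB, hBM.trans (eq_blockMatrix h).symm⟩

/-! ### Frames -/

/-- The values of the symplectic form on the derivatives of order `1, …, 4` of a Lagrangian curve
parametrized by arc-length. -/
structure IsSymplecticJet (κ₃ : ℝ) (f : ℕ → Fin 4 → ℝ) : Prop where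
  h12 : sympForm (f 1) (f 2) = 0
  h13 : sympForm (f 1) (f 3) = 0
  h14 : sympForm (f 1) (f 4) = -1
  h23 : sympForm (f 2) (f 3) = 1
  h24 : sympForm (f 2) (f 4) = 0
  h34 : sympForm (f 3) (f 4) = κ₃

/-- The linear part of the Frenet frame of a jet. -/
def frenetLinearPart (κ₃ : ℝ) (f : ℕ → Fin 4 → ℝ) : Matrix (Fin 4) (Fin 4) ℝ :=
  of fun i j => (![f 1 i, f 2 i, -κ₃ * f 2 i - f 4 i, f 3 i] : Fin 4 → ℝ) j

/-- The term `-κ₃ f 2` in the third column makes it orthogonal to `f 3`; the sign of `f 4` makes its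
product with `f 1` equal to the standard value. `linarith` needs the products of `κ₃` with the
relations as separate facts. -/
theorem IsSymplecticJet.frenetLinearPart_symplectic {κ₃ : ℝ} {f : ℕ → Fin 4 → ℝ}
    (h : IsSymplecticJet κ₃ f) :
    (frenetLinearPart κ₃ f)ᵀ * sympJ * frenetLinearPart κ₃ f = sympJ := by
  obtain ⟨h12, h13, h14, h23, h24, h34⟩ := h
  simp only [sympForm_eq] at h12 h13 h14 h23 h24 h34
  ext i j
  fin_cases i <;> fin_cases j <;>
    simp [frenetLinearPart, sympJ, Matrix.mul_apply, Fin.sum_univ_four] <;>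
    linarith [congrArg (κ₃ * ·) h12, congrArg (κ₃ * ·) h23]

theorem IsSymplecticJet.exists_frame {κ₃ : ℝ} {f : ℕ → Fin 4 → ℝ} (h : IsSymplecticJet κ₃ f) :
    ∃ B ∈ affineSymplecticGroup,
      (B : Matrix (Fin 5) (Fin 5) ℝ) = blockMatrix 1 (f 0) (frenetLinearPart κ₃ f) :=
  exists_affineSymplectic _ h.frenetLinearPart_symplectic

/-- A vector is determined by its products with the elements of a symplectic jet. -/
theorem IsSymplecticJet.eq_of_sympForm_eq {κ₃ : ℝ} {f : ℕ → Fin 4 → ℝ}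
    (h : IsSymplecticJet κ₃ f) {x y : Fin 4 → ℝ}
    (hxy : ∀ i ∈ Finset.Icc 1 4, sympForm (f i) x = sympForm (f i) y) : x = y := by
  have hA := h.frenetLinearPart_symplectic
  -- The transpose of the frame is symplectic as well, hence has a left inverse, and can be
  -- cancelled from the hypothesis in the form `ᵗA J x = ᵗA J y`.
  have h0 := mul_left_inverse_of_symplectic (symplectic_of_transpose (A := (frenetLinearPart κ₃ f)ᵀ)
    (by rwa [transpose_transpose]))
  have h1 : (frenetLinearPart κ₃ f)ᵀ *ᵥ (sympJ *ᵥ x) =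
      (frenetLinearPart κ₃ f)ᵀ *ᵥ (sympJ *ᵥ y) := by
    have e1 := hxy 1 (by simp)
    have e2 := hxy 2 (by simp)
    have e3 := hxy 3 (by simp)
    have e4 := hxy 4 (by simp)
    simp only [sympForm, dotProduct, Fin.sum_univ_four] at e1 e2 e3 e4
    ext i
    fin_cases i <;>
      simp only [Matrix.mulVec, dotProduct, Fin.sum_univ_four, frenetLinearPart] at e1 e2 e3 e4 ⊢ <;>
      simp <;> linarith [congrArg (κ₃ * ·) e2]
  generalize -(sympJ * (frenetLinearPart κ₃ f)ᵀᵀ * sympJ) = C at h0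
  have h2 : sympJ *ᵥ x = sympJ *ᵥ y := by
    simpa only [Matrix.mulVec_mulVec, ← Matrix.mul_assoc, h0, Matrix.one_mul] using
      congrArg (fun v => C *ᵥ v) h1
  simpa [Matrix.mulVec_mulVec, sympJ_mul_self, Matrix.neg_mulVec] using
    congrArg (fun v => sympJ *ᵥ v) h2

/-! ### The Frenet matrix, the affine action and the adjoint action -/

theorem frenetMatrix_eq_blockMatrix (κ₃ κ₄ : ℝ) :
    frenetMatrix κ₃ κ₄ = blockMatrix 0 ![1, 0, 0, 0]
      !![0, 0, κ₃ ^ 2 - κ₄, 0; 1, 0, 0, -κ₃; 0, 0, 0, -1; 0, 1, 0, 0] := by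
  ext i j
  fin_cases i <;> fin_cases j <;> rfl

theorem frenetMatrix_mem (κ₃ κ₄ : ℝ) : frenetMatrix κ₃ κ₄ ∈ affineSymplecticAlgebra := by
  refine ⟨_, _, ?_, frenetMatrix_eq_blockMatrix κ₃ κ₄⟩
  ext i j
  fin_cases i <;> fin_cases j <;> simp [sympJ, Matrix.mul_apply, Fin.sum_univ_four]

theorem frenetMatrix_charpoly (κ₃ κ₄ : ℝ) :
    (frenetMatrix κ₃ κ₄).charpoly = Polynomial.X * quarticPoly κ₃ κ₄ := by
  simp [Matrix.charpoly, Matrix.charmatrix, frenetMatrix, quarticPoly, Matrix.det_succ_row_zero,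
    Fin.sum_univ_succ, Fin.succAbove]
  ring

theorem affineAct_mul_firstColumn {g M : Matrix (Fin 5) (Fin 5) ℝ} (h : M 0 0 = 1) :
    affineAct g (firstColumn M) = firstColumn (g * M) := by
  ext i
  simp [affineAct, firstColumn, Matrix.mul_apply, Matrix.mulVec, dotProduct, Fin.sum_univ_succ, h]

theorem apply_zero_zero_of_mem {g : GL (Fin 5) ℝ} (h : g ∈ affineSymplecticGroup) :
    (g : Matrix (Fin 5) (Fin 5) ℝ) 0 0 = 1 := by
  obtain ⟨a, A, -, h⟩ := h
  rw [h]; rfl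

theorem affineAct_blockMatrix (a : Fin 4 → ℝ) (A : Matrix (Fin 4) (Fin 4) ℝ) (x : Fin 4 → ℝ) :
    affineAct (blockMatrix 1 a A) x = A *ᵥ x + a := by
  ext i
  simp [affineAct, blockMatrix, Matrix.mulVec, dotProduct, Fin.sum_univ_succ, add_comm]

theorem affineAct_mul {g : GL (Fin 5) ℝ} (hg : g ∈ affineSymplecticGroup)
    {h : GL (Fin 5) ℝ} (hh : h ∈ affineSymplecticGroup) (x : Fin 4 → ℝ) :
    affineAct ((g : Matrix (Fin 5) (Fin 5) ℝ) * h) x = affineAct g (affineAct h x) := by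
  obtain ⟨a, A, -, hg⟩ := hg
  obtain ⟨b, B, -, hh⟩ := hh
  rw [hg, hh, blockMatrix_mul]
  simp only [affineAct_blockMatrix, Matrix.mulVec_add, Matrix.mulVec_mulVec, add_assoc]

/-- Conjugation by elements of the group preserves the Lie algebra. -/
theorem conj_mem_affineSymplecticAlgebra {g : GL (Fin 5) ℝ} (hg : g ∈ affineSymplecticGroup)
    {X : Matrix (Fin 5) (Fin 5) ℝ} (hX : X ∈ affineSymplecticAlgebra) :
    (g : Matrix (Fin 5) (Fin 5) ℝ) * X * ((g⁻¹ : GL (Fin 5) ℝ) : Matrix (Fin 5) (Fin 5) ℝ) ∈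
      affineSymplecticAlgebra := by
  have mul_block : ∀ (c d : ℝ) (a b : Fin 4 → ℝ) (A B : Matrix (Fin 4) (Fin 4) ℝ),
      blockMatrix c a A * blockMatrix d b B = blockMatrix (c * d) (A *ᵥ b + d • a) (A * B) := by
    intro c d a b A B
    ext i j
    refine Fin.cases ?_ (fun i => ?_) i <;> refine Fin.cases ?_ (fun j => ?_) j <;>
      simp [blockMatrix, Matrix.mul_apply, Fin.sum_univ_succ, Matrix.mulVec, dotProduct, add_comm,
        mul_comm]
  obtain ⟨a, A, hA, hg'⟩ := hg
  obtain ⟨b, Y, hY, rfl⟩ := hX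
  have hi : ((g⁻¹ : GL (Fin 5) ℝ) : Matrix (Fin 5) (Fin 5) ℝ) = blockMatrix 1
      (-(((A⁻¹ : GL (Fin 4) ℝ) : Matrix (Fin 4) (Fin 4) ℝ) *ᵥ a))
      ((A⁻¹ : GL (Fin 4) ℝ) : Matrix (Fin 4) (Fin 4) ℝ) := by
    apply Units.inv_eq_of_mul_eq_one_right
    rw [hg', blockMatrix_mul, Matrix.mulVec_neg, Matrix.mulVec_mulVec, A.mul_inv,
      Matrix.one_mulVec, neg_add_cancel, blockMatrix_one]
  refine ⟨_, _, ?_, by rw [hg', hi, mul_block, mul_block, mul_zero, zero_mul]⟩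
  have h1 : (A : Matrix (Fin 4) (Fin 4) ℝ) * (A⁻¹ : GL (Fin 4) ℝ) = 1 := A.mul_inv
  have hA : (A : Matrix (Fin 4) (Fin 4) ℝ)ᵀ * sympJ * A = sympJ := hA
  generalize ((A⁻¹ : GL (Fin 4) ℝ) : Matrix (Fin 4) (Fin 4) ℝ) = C at *
  generalize (A : Matrix (Fin 4) (Fin 4) ℝ) = D at *
  have h2 : Cᵀ * Dᵀ = 1 := by rw [← transpose_mul, h1, transpose_one]
  have e1 : sympJ * D = Cᵀ * sympJ := by
    calc sympJ * D = Cᵀ * Dᵀ * (sympJ * D) := by rw [h2, Matrix.one_mul]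
      _ = Cᵀ * (Dᵀ * sympJ * D) := by simp only [Matrix.mul_assoc]
      _ = Cᵀ * sympJ := by rw [hA]
  have e2 : Dᵀ * sympJ = sympJ * C := by
    calc Dᵀ * sympJ = Dᵀ * sympJ * (D * C) := by rw [h1, Matrix.mul_one]
      _ = (Dᵀ * sympJ * D) * C := by simp only [Matrix.mul_assoc]
      _ = sympJ * C := by rw [hA]
  calc (D * Y * C)ᵀ * sympJ + sympJ * (D * Y * C)
      = Cᵀ * Yᵀ * (Dᵀ * sympJ) + (sympJ * D) * Y * C := by
        simp only [transpose_mul, Matrix.mul_assoc]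
    _ = Cᵀ * (Yᵀ * sympJ + sympJ * Y) * C := by
        rw [e1, e2]
        simp only [Matrix.mul_add, Matrix.add_mul, Matrix.mul_assoc]
    _ = 0 := by rw [hY, Matrix.mul_zero, Matrix.zero_mul]

/-! ### Linear differential equations -/

section

open scoped Matrix.Norms.Operator

theorem hasDerivWithinAt_matrix {n : ℕ} {E : ℝ → Matrix (Fin n) (Fin n) ℝ}
    {E' : Matrix (Fin n) (Fin n) ℝ} {I : Set ℝ} {s : ℝ} :
    HasDerivWithinAt E E' I s ↔ ∀ i j, HasDerivWithinAt (fun t => E t i j) (E' i j) I s :=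
  ⟨fun h i j => hasDerivWithinAt_pi.1 (hasDerivWithinAt_pi.1 h i) j,
    fun h => hasDerivWithinAt_pi.2 fun i => hasDerivWithinAt_pi.2 fun j => h i j⟩

theorem hasDerivAt_exp_smul {n : ℕ} (X : Matrix (Fin n) (Fin n) ℝ) (s : ℝ) :
    HasDerivAt (fun t : ℝ => NormedSpace.exp (t • X)) (NormedSpace.exp (s • X) * X) s :=
  hasDerivAt_exp_smul_const X s

theorem hasDerivAt_exp_smul' {n : ℕ} (X : Matrix (Fin n) (Fin n) ℝ) (s : ℝ) :
    HasDerivAt (fun t : ℝ => NormedSpace.exp (t • X)) (X * NormedSpace.exp (s • X)) s :=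
  hasDerivAt_exp_smul_const' X s

theorem exp_neg_smul_mul_exp_smul {n : ℕ} (X : Matrix (Fin n) (Fin n) ℝ) (s : ℝ) :
    NormedSpace.exp (s • -X) * NormedSpace.exp (s • X) = 1 := by
  rw [← Matrix.exp_add_of_commute _ _ (((Commute.refl X).neg_left.smul_left s).smul_right s)]
  simp

/-- The mean value inequality with constant `0`. Derivatives within a convex set suffice, so
endpoints of the interval need no separate treatment. -/
theorem eq_of_hasDerivWithinAt_zero {n : ℕ} {I : Set ℝ} (hI : Convex ℝ I)
    {E : ℝ → Matrix (Fin n) (Fin n) ℝ} (h : ∀ s ∈ I, HasDerivWithinAt E 0 I s) {s t : ℝ}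
    (hs : s ∈ I) (ht : t ∈ I) : E s = E t := by
  have := hI.norm_image_sub_le_of_norm_hasDerivWithin_le (f := E) (f' := fun _ => 0) (C := 0) h
    (by simp) ht hs
  rw [zero_mul] at this
  exact sub_eq_zero.1 (norm_le_zero_iff.1 this)

/-- Solutions of the linear differential equation `E' = E X`. -/
theorem eq_mul_exp_of_hasDerivWithinAt {n : ℕ} {I : Set ℝ} (hI : Convex ℝ I)
    {E : ℝ → Matrix (Fin n) (Fin n) ℝ} {X : Matrix (Fin n) (Fin n) ℝ}
    (h : ∀ s ∈ I, HasDerivWithinAt E (E s * X) I s) {s t : ℝ} (hs : s ∈ I) (ht : t ∈ I) :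
    E s = E t * NormedSpace.exp (t • -X) * NormedSpace.exp (s • X) := by
  -- The product `E u · exp(-uX)` has derivative `E X exp(-uX) - E X exp(-uX) = 0`.
  have h1 : E s * NormedSpace.exp (s • -X) = E t * NormedSpace.exp (t • -X) := by
    refine eq_of_hasDerivWithinAt_zero (E := fun u => E u * NormedSpace.exp (u • -X)) hI
      (fun u hu => ?_) hs ht
    have := (h u hu).mul (hasDerivAt_exp_smul' (-X) u).hasDerivWithinAt
    exact this.congr_deriv (by simp [Matrix.mul_assoc])
  rw [← h1, Matrix.mul_assoc, exp_neg_smul_mul_exp_smul, Matrix.mul_one]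

theorem eq_exp_smul_of_hasDerivAt {n : ℕ} {E : ℝ → Matrix (Fin n) (Fin n) ℝ}
    {X : Matrix (Fin n) (Fin n) ℝ} (h0 : E 0 = 1)
    (h : ∀ s i j, HasDerivAt (fun t => E t i j) ((E s * X) i j) s) (s : ℝ) :
    NormedSpace.exp (s • X) = E s := by
  have := eq_mul_exp_of_hasDerivWithinAt convex_univ (E := E) (X := X)
    (fun u _ => hasDerivWithinAt_matrix.2 fun i j => (h u i j).hasDerivWithinAt)
    (Set.mem_univ s) (Set.mem_univ 0)
  rw [this, h0]
  simp

/-- The exponential map takes the Lie algebra `𝔰(4, ℝ)` to the affine symplectic group. -/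
theorem exists_exp_smul_mem {X : Matrix (Fin 5) (Fin 5) ℝ} (hX : X ∈ affineSymplecticAlgebra)
    (s : ℝ) : ∃ B ∈ affineSymplecticGroup,
      (B : Matrix (Fin 5) (Fin 5) ℝ) = NormedSpace.exp (s • X) := by
  obtain ⟨a, A, hA, rfl⟩ := hX
  set X := blockMatrix 0 a A with hX
  set K := blockMatrix 0 0 sympJ with hK
  refine exists_affineSymplectic_of_form (fun j => ?_) ?_
  -- `blockMatrix 1 0 0` projects to the first row. It annihilates `X`, so the first row of
  -- `exp(uX)` keeps its value at `u = 0`.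
  · have h := eq_of_hasDerivWithinAt_zero convex_univ
      (E := fun u => blockMatrix 1 0 0 * NormedSpace.exp (u • X)) (fun u _ => by
        have := (hasDerivWithinAt_const u Set.univ (blockMatrix 1 0 0)).mul
          (hasDerivAt_exp_smul' X u).hasDerivWithinAt
        refine this.congr_deriv ?_
        have : blockMatrix 1 0 0 * X = 0 := by
          ext i j
          refine Fin.cases ?_ (fun i => ?_) i <;> refine Fin.cases ?_ (fun j => ?_) j <;>
            simp [hX, blockMatrix, Matrix.mul_apply, Fin.sum_univ_succ]
        rw [← Matrix.mul_assoc, this]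
        simp) (Set.mem_univ s) (Set.mem_univ 0)
    have := congrFun (congrFun h 0) j
    simpa [blockMatrix, Matrix.mul_apply, Fin.sum_univ_succ] using this
  -- Likewise `exp(uX) K exp(u ᵗX)` is constant, because its derivative contains the factor `X K + K
  -- ᵗX = 0`.
  · have h := eq_of_hasDerivWithinAt_zero convex_univ
      (E := fun u => NormedSpace.exp (u • X) * K * NormedSpace.exp (u • Xᵀ)) (fun u _ => by
        have := ((hasDerivAt_exp_smul X u).hasDerivWithinAt.mul
          (hasDerivWithinAt_const u Set.univ K)).mul
          (hasDerivAt_exp_smul' Xᵀ u).hasDerivWithinAt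
        refine this.congr_deriv ?_
        have h0 : X * K + K * Xᵀ = 0 := blockMatrix_mul_form_add a hA
        calc _ = NormedSpace.exp (u • X) * (X * K + K * Xᵀ) * NormedSpace.exp (u • Xᵀ) := by
              simp only [Matrix.mul_add, Matrix.add_mul, Matrix.mul_assoc, Matrix.mul_zero,
                add_zero, Pi.mul_apply]
          _ = 0 := by rw [h0, Matrix.mul_zero, Matrix.zero_mul]) (Set.mem_univ s) (Set.mem_univ 0)
    rw [← Matrix.exp_transpose, transpose_smul]
    simpa using h

/-! ### Curves with given jets -/

/-- The functions `f 0, …, f 4` are the successive derivatives of a curve with constant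
curvatures. -/
structure IsFrenetChain (κ₃ κ₄ : ℝ) (I : Set ℝ) (f : ℕ → ℝ → Fin 4 → ℝ) : Prop where
  deriv : ∀ i < 5, ∀ t ∈ I, HasDerivWithinAt (f i) (f (i + 1) t) I t
  eq : ∀ t ∈ I, ∀ j, f 5 t j = -κ₃ * f 3 t j - (κ₃ ^ 2 - κ₄) * f 1 t j

theorem mul_frenetMatrix (κ₃ κ₄ : ℝ) (M : Matrix (Fin 5) (Fin 5) ℝ) :
    M * frenetMatrix κ₃ κ₄ = of fun i j =>
      (![M i 1, M i 2, M i 4, (κ₃ ^ 2 - κ₄) * M i 1, -κ₃ * M i 2 - M i 3] : Fin 5 → ℝ) j := by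
  ext i j
  fin_cases j <;> simp [frenetMatrix, Matrix.mul_apply, Fin.sum_univ_five] <;> ring

/-- The columns are `γ, γ', γ'', -κ₃γ'' - γ'''', γ'''`. Only the fourth uses the fifth-order
equation: its derivative `-κ₃γ''' - γ⁽⁵⁾` equals `(κ₃² - κ₄)γ'`. -/
theorem IsFrenetChain.hasDerivWithinAt_frame {κ₃ κ₄ : ℝ} {I : Set ℝ} {f : ℕ → ℝ → Fin 4 → ℝ}
    (h : IsFrenetChain κ₃ κ₄ I f) {t : ℝ} (ht : t ∈ I) :
    HasDerivWithinAt (fun t => blockMatrix 1 (f 0 t) (frenetLinearPart κ₃ fun i => f i t))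
      (blockMatrix 1 (f 0 t) (frenetLinearPart κ₃ fun i => f i t) * frenetMatrix κ₃ κ₄) I t := by
  refine hasDerivWithinAt_matrix.2 fun i j => ?_
  have hd : ∀ i < 5, ∀ j, HasDerivWithinAt (fun t => f i t j) (f (i + 1) t j) I t :=
    fun i hi j => hasDerivWithinAt_pi.1 (h.deriv i hi t ht) j
  rw [mul_frenetMatrix]
  refine Fin.cases ?_ (fun i => ?_) i
  · fin_cases j
    · exact hasDerivWithinAt_const t I (1 : ℝ)
    · exact hasDerivWithinAt_const t I (0 : ℝ)
    · exact hasDerivWithinAt_const t I (0 : ℝ)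
    · exact (hasDerivWithinAt_const t I (0 : ℝ)).congr_deriv (mul_zero _).symm
    · refine (hasDerivWithinAt_const t I (0 : ℝ)).congr_deriv ?_
      change (0 : ℝ) = -κ₃ * (0 : ℝ) - (0 : ℝ)
      simp
  · have e := h.eq t ht i
    fin_cases j
    · exact hd 0 (by norm_num) i
    · exact hd 1 (by norm_num) i
    · exact hd 2 (by norm_num) i
    · refine (((hd 2 (by norm_num) i).const_mul (-κ₃)).sub (hd 4 (by norm_num) i)).congr_deriv ?_
      change -κ₃ * f 3 t i - f 5 t i = (κ₃ ^ 2 - κ₄) * f 1 t i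
      rw [e]
      ring
    · refine (hd 3 (by norm_num) i).congr_deriv ?_
      change f 4 t i = -κ₃ * f 2 t i - (-κ₃ * f 2 t i - f 4 t i)
      ring

/-- A curve with constant curvatures is the first column of `B exp(sA)`. -/
theorem IsFrenetChain.exists_eq_firstColumn {κ₃ κ₄ : ℝ} {I : Set ℝ} {f : ℕ → ℝ → Fin 4 → ℝ}
    (h : IsFrenetChain κ₃ κ₄ I f) (hI : Convex ℝ I) {t : ℝ} (ht : t ∈ I)
    (hf : IsSymplecticJet κ₃ fun i => f i t) :
    ∃ B ∈ affineSymplecticGroup, ∀ s ∈ I, f 0 s =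
      firstColumn ((B : Matrix (Fin 5) (Fin 5) ℝ) *
        NormedSpace.exp (s • frenetMatrix κ₃ κ₄)) := by
  obtain ⟨B, hB, hBf⟩ := hf.exists_frame
  -- The interval may not contain `0`, so the frame at `t` is carried back to parameter `0` by
  -- `exp(-tA)`.
  obtain ⟨C, hC, hCf⟩ := exists_exp_smul_mem (frenetMatrix_mem κ₃ κ₄) (-t)
  refine ⟨B * C, mul_mem hB hC, fun s hs => ?_⟩
  have := eq_mul_exp_of_hasDerivWithinAt hI (fun u hu => h.hasDerivWithinAt_frame hu) hs ht
  rw [Units.val_mul, hBf, hCf, neg_smul, ← smul_neg, ← this]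
  ext i
  rfl

end

/-! ### Curves with constant curvatures -/

theorem IsCurveDomain.uniqueDiffOn {I : Set ℝ} (hI : IsCurveDomain I) : UniqueDiffOn ℝ I :=
  uniqueDiffOn_convex hI.1.convex (hI.1.convex.nontrivial_iff_nonempty_interior.1 hI.2)

theorem HasDerivWithinAt.sympForm {u v : ℝ → Fin 4 → ℝ} {u' v' : Fin 4 → ℝ} {I : Set ℝ} {t : ℝ}
    (hu : HasDerivWithinAt u u' I t) (hv : HasDerivWithinAt v v' I t) :
    HasDerivWithinAt (fun s => sympForm (u s) (v s))
      (sympForm u' (v t) + sympForm (u t) v') I t := by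
  have hu := hasDerivWithinAt_pi.1 hu
  have hv := hasDerivWithinAt_pi.1 hv
  simp only [sympForm_eq]
  exact (((((hu 0).mul (hv 2)).add ((hu 1).mul (hv 3))).sub ((hu 2).mul (hv 0))).sub
    ((hu 3).mul (hv 1))).congr_deriv (by ring)

theorem sympForm_deriv_add_eq_zero {u v u' v' : ℝ → Fin 4 → ℝ} {I : Set ℝ}
    (hI : UniqueDiffOn ℝ I) (hu : ∀ t ∈ I, HasDerivWithinAt u (u' t) I t)
    (hv : ∀ t ∈ I, HasDerivWithinAt v (v' t) I t) {c : ℝ}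
    (h : ∀ t ∈ I, sympForm (u t) (v t) = c) {t : ℝ} (ht : t ∈ I) :
    sympForm (u' t) (v t) + sympForm (u t) (v' t) = 0 :=
  ((hI t ht).eq_deriv _ ((hu t ht).sympForm (hv t ht))
    ((hasDerivWithinAt_const t I c).congr h (h t ht)))

/-- Differentiating a constant product `Λ(γ⁽ⁱ⁾, γ⁽ʲ⁾)` gives `Λ(γ⁽ⁱ⁺¹⁾, γ⁽ʲ⁾) + Λ(γ⁽ⁱ⁾, γ⁽ʲ⁺¹⁾) =
0`. Starting from the curvatures, this yields all products of orders `1, …, 5` used below. -/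
theorem HasConstantCurvatures.exists_jet {γ : ℝ → Fin 4 → ℝ} {I : Set ℝ} {κ₃ κ₄ : ℝ}
    (h : HasConstantCurvatures γ I κ₃ κ₄) (hI : UniqueDiffOn ℝ I) :
    IsFrenetChain κ₃ κ₄ I (fun i => iteratedDerivWithin i γ I) ∧
      ∀ t ∈ I, IsSymplecticJet κ₃ fun i => iteratedDerivWithin i γ I t := by
  have hd : ∀ i, ∀ t ∈ I, HasDerivWithinAt (iteratedDerivWithin i γ I)
      (iteratedDerivWithin (i + 1) γ I t) I t := fun i t ht => by
    rw [iteratedDerivWithin_succ]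
    exact (h.lagrangian.smooth.differentiableOn_iteratedDerivWithin
      (by exact_mod_cast WithTop.coe_lt_top i) hI t ht).hasDerivWithinAt
  have h12 := h.lagrangian.isotropic
  have h23 := h.arcLength
  have h34 := h.curvature_three
  have h45 := h.curvature_four
  simp only [sympCurvature, Nat.reduceAdd] at h12 h23 h34 h45
  set f := fun i => iteratedDerivWithin i γ I with hf
  change ∀ i, ∀ t ∈ I, HasDerivWithinAt (f i) (f (i + 1) t) I t at hd
  change ∀ t ∈ I, sympForm (f 1 t) (f 2 t) = 0 at h12
  change ∀ t ∈ I, sympForm (f 2 t) (f 3 t) = 1 at h23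
  change ∀ t ∈ I, sympForm (f 3 t) (f 4 t) = κ₃ at h34
  change ∀ t ∈ I, sympForm (f 4 t) (f 5 t) = κ₄ at h45
  have hs : ∀ x, sympForm x x = 0 := fun x => by rw [sympForm_eq]; ring
  have key : ∀ (i j : ℕ) (c : ℝ), (∀ t ∈ I, sympForm (f i t) (f j t) = c) → ∀ t ∈ I,
      sympForm (f (i + 1) t) (f j t) + sympForm (f i t) (f (j + 1) t) = 0 :=
    fun i j c hc t ht => sympForm_deriv_add_eq_zero hI (hd i) (hd j) hc ht
  have h13 : ∀ t ∈ I, sympForm (f 1 t) (f 3 t) = 0 := fun t ht => by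
    linarith [key 1 2 0 h12 t ht, hs (f 2 t)]
  have h14 : ∀ t ∈ I, sympForm (f 1 t) (f 4 t) = -1 := fun t ht => by
    linarith [key 1 3 0 h13 t ht, h23 t ht]
  have h24 : ∀ t ∈ I, sympForm (f 2 t) (f 4 t) = 0 := fun t ht => by
    linarith [key 2 3 1 h23 t ht, hs (f 3 t)]
  have h15 : ∀ t ∈ I, sympForm (f 1 t) (f 5 t) = 0 := fun t ht => by
    linarith [key 1 4 (-1) h14 t ht, h24 t ht]
  have h25 : ∀ t ∈ I, sympForm (f 2 t) (f 5 t) = -κ₃ := fun t ht => by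
    linarith [key 2 4 0 h24 t ht, h34 t ht]
  have h35 : ∀ t ∈ I, sympForm (f 3 t) (f 5 t) = 0 := fun t ht => by
    linarith [key 3 4 κ₃ h34 t ht, hs (f 4 t)]
  have hj : ∀ t ∈ I, IsSymplecticJet κ₃ fun i => f i t := fun t ht =>
    ⟨h12 t ht, h13 t ht, h14 t ht, h23 t ht, h24 t ht, h34 t ht⟩
  refine ⟨⟨fun i _ => hd i, fun t ht j => ?_⟩, hj⟩
  -- Both sides have the same products with the jet; `κ₄` enters only through `Λ(γ'''', γ⁽⁵⁾)`.
  have e : f 5 t = -κ₃ • f 3 t - (κ₃ ^ 2 - κ₄) • f 1 t := by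
    refine (hj t ht).eq_of_sympForm_eq fun i hi => ?_
    have hl : ∀ x, sympForm x (-κ₃ • f 3 t - (κ₃ ^ 2 - κ₄) • f 1 t) =
        -κ₃ * sympForm x (f 3 t) + (κ₃ ^ 2 - κ₄) * sympForm (f 1 t) x := fun x => by
      simp only [sympForm_eq, Pi.sub_apply, Pi.smul_apply, smul_eq_mul]
      ring
    rw [hl]
    rw [Finset.mem_Icc] at hi
    obtain ⟨hi1, hi4⟩ := hi
    interval_cases i
    · rw [h15 t ht, h13 t ht, hs]; ring
    · rw [h25 t ht, h23 t ht, h12 t ht]; ring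
    · rw [h35 t ht, hs, h13 t ht]; ring
    · rw [h45 t ht, sympForm_swap, h34 t ht, h14 t ht]; ring
  simpa using congrFun e j

theorem iteratedDerivWithin_eq_of_chain {γ : ℝ → Fin 4 → ℝ} {I : Set ℝ} (hI : UniqueDiffOn ℝ I)
    {f : ℕ → ℝ → Fin 4 → ℝ} {n : ℕ}
    (hd : ∀ i < n, ∀ t ∈ I, HasDerivWithinAt (f i) (f (i + 1) t) I t)
    (h0 : ∀ t ∈ I, γ t = f 0 t) {k : ℕ} (hk : k ≤ n) :
    ∀ t ∈ I, iteratedDerivWithin k γ I t = f k t := by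
  induction k with
  | zero => simpa using h0
  | succ k ih =>
    intro t ht
    have ih := ih (by omega)
    rw [iteratedDerivWithin_succ, derivWithin_congr ih (ih t ht)]
    exact (hd k (by omega) t ht).derivWithin (hI t ht)

/-- The jet contains every product required except `κ₄`, which results from pairing `γ''''` with the
fifth-order equation. Independence of `γ'` and `γ''` is seen by pairing with `γ'''` and `γ''''`. -/
theorem IsFrenetChain.hasConstantCurvatures {κ₃ κ₄ : ℝ} {I : Set ℝ} {f : ℕ → ℝ → Fin 4 → ℝ}
    (h : IsFrenetChain κ₃ κ₄ I f) (hI : UniqueDiffOn ℝ I) {γ : ℝ → Fin 4 → ℝ}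
    (h0 : ∀ t ∈ I, γ t = f 0 t) (hγ : ContDiffOn ℝ ∞ γ I)
    (hf : ∀ t ∈ I, IsSymplecticJet κ₃ fun i => f i t) : HasConstantCurvatures γ I κ₃ κ₄ := by
  have e : ∀ k ≤ 5, ∀ t ∈ I, iteratedDerivWithin k γ I t = f k t := fun k hk =>
    iteratedDerivWithin_eq_of_chain hI h.deriv h0 hk
  have e1 := e 1 (by norm_num)
  have e2 := e 2 (by norm_num)
  have e3 := e 3 (by norm_num)
  have e4 := e 4 (by norm_num)
  have e5 := e 5 (by norm_num)
  refine ⟨⟨hγ, fun t ht => ?_, fun t ht => ?_⟩, fun t ht => ?_, fun t ht => ?_, fun t ht => ?_⟩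
  · rw [e1 t ht, e2 t ht, LinearIndependent.pair_iff]
    intro a b hab
    have h13 := (hf t ht).h13
    have h14 := (hf t ht).h14
    have h23 := (hf t ht).h23
    have h24 := (hf t ht).h24
    have hl : ∀ x, sympForm (a • f 1 t + b • f 2 t) x =
        a * sympForm (f 1 t) x + b * sympForm (f 2 t) x := fun x => by
      simp only [sympForm_eq, Pi.add_apply, Pi.smul_apply, smul_eq_mul]
      ring
    have hz : ∀ x, sympForm 0 x = 0 := fun x => by simp [sympForm_eq]
    have h3 := hl (f 3 t)
    have h4 := hl (f 4 t)
    rw [hab, hz] at h3 h4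
    constructor
    · rw [h14, h24] at h4; linarith
    · rw [h13, h23] at h3; linarith
  · simpa only [sympCurvature, e1 t ht, e2 t ht] using (hf t ht).h12
  · simpa only [sympCurvature, e2 t ht, e3 t ht] using (hf t ht).h23
  · simpa only [sympCurvature, e3 t ht, e4 t ht] using (hf t ht).h34
  · have e : f 5 t = fun j => -κ₃ * f 3 t j - (κ₃ ^ 2 - κ₄) * f 1 t j := funext (h.eq t ht)
    have h34 := (hf t ht).h34
    have h14 := (hf t ht).h14
    simp only [sympCurvature, e4 t ht, e5 t ht, e]
    rw [sympForm_eq] at h34 h14 ⊢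
    linear_combination κ₃ * h34 + (κ₃ ^ 2 - κ₄) * h14

/-! ### Curves as first columns of `B exp(sA)`, and their congruence -/

theorem sympForm_columns {g : GL (Fin 5) ℝ} (hg : g ∈ affineSymplecticGroup) (i j : Fin 4) :
    sympForm (fun k => (g : Matrix (Fin 5) (Fin 5) ℝ) k.succ i.succ)
      (fun k => (g : Matrix (Fin 5) (Fin 5) ℝ) k.succ j.succ) = sympJ i j := by
  obtain ⟨a, A, hA, hg⟩ := hg
  have hA : (A : Matrix (Fin 4) (Fin 4) ℝ)ᵀ * sympJ * A = sympJ := hA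
  rw [hg]
  conv_rhs => rw [← hA]
  change sympForm (fun k => (A : Matrix (Fin 4) (Fin 4) ℝ) k i)
    (fun k => (A : Matrix (Fin 4) (Fin 4) ℝ) k j) = _
  simp [sympForm_eq, Matrix.mul_apply, Fin.sum_univ_four, sympJ]
  ring

section

open scoped Matrix.Norms.Operator

theorem contDiff_firstColumn_mul_exp (B X : Matrix (Fin 5) (Fin 5) ℝ) :
    ContDiff ℝ ∞ fun s : ℝ => firstColumn (B * NormedSpace.exp (s • X)) := by
  have h : ContDiff ℝ ∞ fun s : ℝ => B * NormedSpace.exp (s • X) := by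
    refine contDiff_const.mul ?_
    refine ContDiff.comp (g := NormedSpace.exp) ?_ (contDiff_id.smul contDiff_const)
    exact AnalyticOnNhd.contDiff (fun x _ => NormedSpace.exp_analytic x)
  refine contDiff_pi.2 fun i => ?_
  let L : Matrix (Fin 5) (Fin 5) ℝ →L[ℝ] ℝ :=
    LinearMap.toContinuousLinearMap (Matrix.entryLinearMap ℝ ℝ i.succ 0)
  exact L.contDiff.comp h

theorem hasConstantCurvatures_iff {I : Set ℝ} {γ : ℝ → Fin 4 → ℝ} (hI : IsCurveDomain I)
    (κ₃ κ₄ : ℝ) : HasConstantCurvatures γ I κ₃ κ₄ ↔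
      ∃ B ∈ affineSymplecticGroup, ∀ s ∈ I, γ s =
        firstColumn ((B : Matrix (Fin 5) (Fin 5) ℝ) *
          NormedSpace.exp (s • frenetMatrix κ₃ κ₄)) := by
  constructor
  · intro h
    obtain ⟨t, ht⟩ := hI.2.nonempty
    obtain ⟨hc, hj⟩ := h.exists_jet hI.uniqueDiffOn
    simpa using hc.exists_eq_firstColumn hI.1.convex ht (hj t ht)
  · rintro ⟨B, hB, h⟩
    set F := fun s : ℝ => (B : Matrix (Fin 5) (Fin 5) ℝ) *
      NormedSpace.exp (s • frenetMatrix κ₃ κ₄) with hF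
    have hFd : ∀ s i j, HasDerivWithinAt (fun t => F t i j)
        ((![F s i 1, F s i 2, F s i 4, (κ₃ ^ 2 - κ₄) * F s i 1, -κ₃ * F s i 2 - F s i 3] :
          Fin 5 → ℝ) j) I s := fun s i j => by
      have := ((hasDerivWithinAt_const s I (B : Matrix (Fin 5) (Fin 5) ℝ)).mul
        (hasDerivAt_exp_smul (frenetMatrix κ₃ κ₄) s).hasDerivWithinAt).congr_deriv
        (show _ = F s * frenetMatrix κ₃ κ₄ by simp [hF, Matrix.mul_assoc])
      rw [mul_frenetMatrix] at this
      exact hasDerivWithinAt_matrix.1 this i j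
    have hFm : ∀ s, ∃ g ∈ affineSymplecticGroup, (g : Matrix (Fin 5) (Fin 5) ℝ) = F s :=
      fun s => by
        obtain ⟨C, hC, hCs⟩ := exists_exp_smul_mem (frenetMatrix_mem κ₃ κ₄) s
        exact ⟨B * C, mul_mem hB hC, by rw [Units.val_mul, hCs]⟩
    -- The derivatives of the curve read off the columns of `F`; `γ''''` is recovered from the
    -- column `-κ₃γ'' - γ''''`. The last branch is used only at index `5`.
    let f : ℕ → ℝ → Fin 4 → ℝ := fun k s i => match k with
      | 0 => F s i.succ 0
      | 1 => F s i.succ 1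
      | 2 => F s i.succ 2
      | 3 => F s i.succ 4
      | 4 => -κ₃ * F s i.succ 2 - F s i.succ 3
      | _ => -κ₃ * F s i.succ 4 - (κ₃ ^ 2 - κ₄) * F s i.succ 1
    have hc : IsFrenetChain κ₃ κ₄ I f := by
      refine ⟨fun k hk s _ => hasDerivWithinAt_pi.2 fun i => ?_, fun _ _ _ => rfl⟩
      interval_cases k
      · exact hFd s i.succ 0
      · exact hFd s i.succ 1
      · exact hFd s i.succ 2
      · exact hFd s i.succ 4
      · exact ((hFd s i.succ 2).const_mul (-κ₃)).sub (hFd s i.succ 3)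
    refine hc.hasConstantCurvatures hI.uniqueDiffOn h ?_ fun t _ => ?_
    · exact (contDiff_firstColumn_mul_exp _ _).contDiffOn.congr h
    · obtain ⟨g, hg, hgF⟩ := hFm t
      have hJ := sympForm_columns hg
      rw [hgF] at hJ
      have e12 := hJ 0 1
      have e13 := hJ 0 3
      have e14 := hJ 0 2
      have e23 := hJ 1 3
      have e24 := hJ 1 2
      have e34 := hJ 3 2
      simp only [sympForm_eq] at e12 e13 e14 e23 e24 e34
      simp [sympJ] at e12 e13 e14 e23 e24 e34
      constructor <;> simp only [f, sympForm_eq] <;> simp <;> 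
        linarith [congrArg (κ₃ * ·) e12, congrArg (κ₃ * ·) e23]

end

/-- Every curve with constant curvatures is an orbit of a one-parameter subgroup. -/
theorem HasConstantCurvatures.isOrbit {I : Set ℝ} {γ : ℝ → Fin 4 → ℝ} (hI : IsCurveDomain I)
    {κ₃ κ₄ : ℝ} (h : HasConstantCurvatures γ I κ₃ κ₄) : IsOrbitOfOneParameterSubgroup γ I := by
  obtain ⟨B, hB, h⟩ := (hasConstantCurvatures_iff hI κ₃ κ₄).1 h
  -- Conjugation by `B` turns `B exp(sA)` into `exp(sX) B`, so the point moved is the first column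
  -- of `B`.
  set X := (B : Matrix (Fin 5) (Fin 5) ℝ) * frenetMatrix κ₃ κ₄ *
    ((B⁻¹ : GL (Fin 5) ℝ) : Matrix (Fin 5) (Fin 5) ℝ) with hX
  have hXm : X ∈ affineSymplecticAlgebra := conj_mem_affineSymplecticAlgebra hB (frenetMatrix_mem _ _)
  choose E hE hEX using exists_exp_smul_mem hXm
  refine ⟨X, hXm, MonoidHom.mk' (fun t => ⟨E t.toAdd, hE _⟩) fun s t => ?_, fun t => hEX t,
    firstColumn B, fun s hs => ?_⟩
  · refine Subtype.ext (Units.ext ?_)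
    change (E (s.toAdd + t.toAdd) : Matrix (Fin 5) (Fin 5) ℝ) = E s.toAdd * E t.toAdd
    rw [hEX, hEX, hEX, add_smul, Matrix.exp_add_of_commute]
    exact ((Commute.refl X).smul_left _).smul_right _
  · change γ s = affineAct (E s) _
    rw [affineAct_mul_firstColumn (apply_zero_zero_of_mem hB), h s hs, hEX, hX]
    rw [← smul_mul_assoc, ← mul_smul_comm, Matrix.exp_units_conj, Matrix.mul_assoc,
      ← Units.val_mul, inv_mul_cancel, Units.val_one, Matrix.mul_one]

/-- A curve is a normal form if it has constant curvatures on the whole line. -/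
theorem IsFrenetChain.isNormalForm {κ₃ κ₄ : ℝ} {f : ℕ → ℝ → Fin 4 → ℝ}
    (h : IsFrenetChain κ₃ κ₄ Set.univ f) (hf : IsSymplecticJet κ₃ fun i => f i 0) :
    IsNormalForm κ₃ κ₄ (f 0) := by
  intro I γ hI
  obtain ⟨C, hC, h0⟩ := h.exists_eq_firstColumn convex_univ (Set.mem_univ 0) hf
  have h0 := fun s => h0 s (Set.mem_univ s)
  -- The model curve is the first column of `C exp(sA)`, so applying `g` replaces `C` by `g C`.
  -- Every `B` in the group is of this form, with `g = B C⁻¹`.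
  have key : ∀ g ∈ affineSymplecticGroup, ∀ s, affineAct g (f 0 s) =
      firstColumn (((g * C : GL (Fin 5) ℝ) : Matrix (Fin 5) (Fin 5) ℝ) *
        NormedSpace.exp (s • frenetMatrix κ₃ κ₄)) := fun g _ s => by
    obtain ⟨E, hE, hEs⟩ := exists_exp_smul_mem (frenetMatrix_mem κ₃ κ₄) s
    rw [h0, ← hEs, ← Units.val_mul, affineAct_mul_firstColumn
      (apply_zero_zero_of_mem (mul_mem hC hE)), Units.val_mul, Units.val_mul, Matrix.mul_assoc]
  rw [hasConstantCurvatures_iff hI]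
  constructor
  · rintro ⟨B, hB, hγ⟩
    refine ⟨B * C⁻¹, mul_mem hB (inv_mem hC), fun s hs => ?_⟩
    rw [key _ (mul_mem hB (inv_mem hC)), inv_mul_cancel_right, hγ s hs]
  · rintro ⟨g, hg, hγ⟩
    exact ⟨g * C, mul_mem hg hC, fun s hs => by rw [hγ s hs, key g hg]⟩

/-! ### Normal forms -/

theorem IsNormalForm.of_congruent {κ₃ κ₄ : ℝ} {γ₀ γ₁ : ℝ → Fin 4 → ℝ}
    (h : IsNormalForm κ₃ κ₄ γ₀) {g : GL (Fin 5) ℝ} (hg : g ∈ affineSymplecticGroup)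
    (hγ : ∀ s, γ₁ s = affineAct g (γ₀ s)) : IsNormalForm κ₃ κ₄ γ₁ := by
  intro I γ hI
  rw [h I γ hI]
  constructor
  · rintro ⟨k, hk, hs⟩
    refine ⟨k * g⁻¹, mul_mem hk (inv_mem hg), fun s hI => ?_⟩
    rw [hs s hI, hγ, ← affineAct_mul (mul_mem hk (inv_mem hg)) hg, ← Units.val_mul,
      inv_mul_cancel_right]
  · rintro ⟨k, hk, hs⟩
    exact ⟨k * g, mul_mem hk hg, fun s hI => by
      rw [hs s hI, hγ, Units.val_mul, affineAct_mul hk hg]⟩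

/-- A curve whose coordinates are linear combinations of a solution `φ` of a linear differential
equation `φ' = N φ` is a normal form as soon as `N π(N) = 0` and its jet at `0` is symplectic. -/
theorem isNormalForm_of_linear {n : ℕ} {κ₃ κ₄ : ℝ} {γ : ℝ → Fin 4 → ℝ} {φ : ℝ → Fin n → ℝ}
    (N M : Matrix (Fin n) (Fin n) ℝ) (C : Matrix (Fin 4) (Fin n) ℝ) (v : ℕ → Fin n → ℝ)
    (hφ : ∀ s i, HasDerivAt (fun t => φ t i) ((N *ᵥ φ s) i) s)
    (hM : N * N = M) (hN : N * (M * M + κ₃ • M + (κ₃ ^ 2 - κ₄) • (1 : Matrix (Fin n) (Fin n) ℝ)) = 0)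
    (hγ : ∀ s, γ s = C *ᵥ φ s) (hv0 : φ 0 = v 0) (hv : ∀ i < 4, v (i + 1) = N *ᵥ v i)
    (hj : IsSymplecticJet κ₃ fun i => C *ᵥ v i) : IsNormalForm κ₃ κ₄ γ := by
  have e0 : γ = fun s => (C * N ^ 0) *ᵥ φ s := by
    ext s : 1
    rw [hγ, pow_zero, Matrix.mul_one]
  have hv' : ∀ i ≤ 4, v i = N ^ i *ᵥ v 0 := fun i => by
    induction i with
    | zero => intro _; simp
    | succ i ih =>
      intro hi
      rw [hv i (by omega), ih (by omega), Matrix.mulVec_mulVec, ← pow_succ']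
  rw [e0]
  refine IsFrenetChain.isNormalForm (f := fun k s => (C * N ^ k) *ᵥ φ s) ⟨?_, ?_⟩ ?_
  · intro k _ t _
    refine hasDerivWithinAt_pi.2 fun i => HasDerivAt.hasDerivWithinAt ?_
    have : (C * N ^ (k + 1)) *ᵥ φ t = (C * N ^ k) *ᵥ (N *ᵥ φ t) := by
      rw [Matrix.mulVec_mulVec, Matrix.mul_assoc, pow_succ]
    simp only [this]
    simp only [Matrix.mulVec, dotProduct]
    exact HasDerivAt.fun_sum fun j _ => (hφ t j).const_mul _
  · intro t _ j
    -- The derivatives of `C φ` are `C Nᵏ φ`, so `N π(N) = 0`, expanded, is the fifth-order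
    -- equation. `M` stands for `N²`, to keep the entrywise verification of the hypothesis small.
    have h5 : N ^ 5 = -κ₃ • N ^ 3 - (κ₃ ^ 2 - κ₄) • N := by
      have e : N * (M * M + κ₃ • M + (κ₃ ^ 2 - κ₄) • (1 : Matrix (Fin n) (Fin n) ℝ)) =
          N ^ 5 + κ₃ • N ^ 3 + (κ₃ ^ 2 - κ₄) • N := by
        rw [← hM]
        simp only [Matrix.mul_add, Matrix.mul_smul, Matrix.mul_one, ← pow_succ', ← pow_two,
          ← pow_mul]
        norm_num
      rw [e] at hN
      rw [neg_smul, ← sub_eq_zero, ← hN]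
      abel
    simp only [h5, pow_one, Matrix.mul_sub, Matrix.mul_smul, Matrix.sub_mulVec,
      Matrix.smul_mulVec, Pi.sub_apply, Pi.smul_apply, smul_eq_mul]
  · have e : ∀ i ≤ 4, (C * N ^ i) *ᵥ φ 0 = C *ᵥ v i := fun i hi => by
      rw [hv' i hi, ← hv0, Matrix.mulVec_mulVec]
    obtain ⟨h12, h13, h14, h23, h24, h34⟩ := hj
    constructor <;> simpa only [e 1 (by norm_num), e 2 (by norm_num), e 3 (by norm_num),
      e 4 (by norm_num)]

/-- Solutions of the equation `C'' = ε C`, in terms of which the curves are expressed: the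
trigonometric functions for `ε = -1` and the hyperbolic functions for `ε = 1`. -/
structure IsTrigPair (ε : ℝ) (S C : ℝ → ℝ) : Prop where
  sq : ε ^ 2 = 1
  derivS : ∀ s, HasDerivAt S (C s) s
  derivC : ∀ s, HasDerivAt C (ε * S s) s
  S_zero : S 0 = 0
  C_zero : C 0 = 1

theorem isTrigPair_sin_cos : IsTrigPair (-1) Real.sin Real.cos :=
  ⟨by norm_num, Real.hasDerivAt_sin, fun s => by simpa using Real.hasDerivAt_cos s,
    Real.sin_zero, Real.cos_zero⟩

theorem isTrigPair_sinh_cosh : IsTrigPair 1 Real.sinh Real.cosh :=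
  ⟨by norm_num, Real.hasDerivAt_sinh, fun s => by simpa using Real.hasDerivAt_cosh s,
    Real.sinh_zero, Real.cosh_zero⟩

theorem IsTrigPair.hasDerivAt_S {ε : ℝ} {S C : ℝ → ℝ} (h : IsTrigPair ε S C) (μ s : ℝ) :
    HasDerivAt (fun t => S (μ * t)) (μ * C (μ * s)) s :=
  (((h.derivS (μ * s)).comp s ((hasDerivAt_id s).const_mul μ))).congr_deriv (by ring)

theorem IsTrigPair.hasDerivAt_C {ε : ℝ} {S C : ℝ → ℝ} (h : IsTrigPair ε S C) (μ s : ℝ) :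
    HasDerivAt (fun t => C (μ * t)) (ε * μ * S (μ * s)) s :=
  (((h.derivC (μ * s)).comp s ((hasDerivAt_id s).const_mul μ))).congr_deriv (by ring)

/-- Cases I.2.a, b, c at once. The frequency `ν` lives in the symplectic plane of coordinates `0,
2`, the frequency `μ` in that of coordinates `1, 3`. At `s = 0`, `Λ(γ', γ'') = η(a²ν³ - b²μ³)`, so
both terms are set to a common value `r`; then `Λ(γ'', γ''') = r(μ² - εην²)`, which `hr` normalizes.
The factor `εη` in the first coordinate makes these signs come out. -/
theorem isNormalForm_of_two_frequencies {ε η : ℝ} {S C S' C' : ℝ → ℝ} (h : IsTrigPair ε S C)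
    (h' : IsTrigPair η S' C') {μ ν a b r κ₃ κ₄ : ℝ} (ha : a ^ 2 * ν ^ 3 = r)
    (hb : b ^ 2 * μ ^ 3 = r) (hr : r * (μ ^ 2 - ε * η * ν ^ 2) = 1)
    (hκ₃ : κ₃ = -(ε * ν ^ 2 + η * μ ^ 2)) (hκ₄ : κ₃ ^ 2 - κ₄ = ε * η * μ ^ 2 * ν ^ 2) :
    IsNormalForm κ₃ κ₄ fun s =>
      ![ε * η * a * S (ν * s), b * C' (μ * s), a * C (ν * s), b * S' (μ * s)] := by
  have hε := h.sq
  have hη := h'.sq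
  refine isNormalForm_of_linear (n := 4)
    (φ := fun s => ![S (ν * s), C' (μ * s), C (ν * s), S' (μ * s)])
    !![0, 0, ν, 0; 0, 0, 0, η * μ; ε * ν, 0, 0, 0; 0, μ, 0, 0]
    !![ε * ν ^ 2, 0, 0, 0; 0, η * μ ^ 2, 0, 0; 0, 0, ε * ν ^ 2, 0; 0, 0, 0, η * μ ^ 2]
    !![ε * η * a, 0, 0, 0; 0, b, 0, 0; 0, 0, a, 0; 0, 0, 0, b]
    (fun i => match i with
      | 0 => ![0, 1, 1, 0]
      | 1 => ![ν, 0, 0, μ]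
      | 2 => ![0, η * μ ^ 2, ε * ν ^ 2, 0]
      | 3 => ![ε * ν ^ 3, 0, 0, η * μ ^ 3]
      | _ => ![0, μ ^ 4, ν ^ 4, 0])
    (fun s i => ?_) ?_ ?_ (fun s => ?_) ?_ (fun i hi => ?_) ?_
  · fin_cases i
    · exact (h.hasDerivAt_S ν s).congr_deriv (by simp [mul_comm])
    · exact (h'.hasDerivAt_C μ s).congr_deriv (by simp [mul_comm])
    · exact (h.hasDerivAt_C ν s).congr_deriv (by simp [mul_comm])
    · exact (h'.hasDerivAt_S μ s).congr_deriv (by simp [mul_comm])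
  · ext i j
    fin_cases i <;> fin_cases j <;> simp [Matrix.mul_apply, Fin.sum_univ_four] <;> ring
  · rw [hκ₄]
    -- Here already `π(N) = 0`, since `π(λ) = (λ² - εν²)(λ² - ημ²)`.
    convert Matrix.mul_zero _
    ext i j
    fin_cases i <;> fin_cases j <;>
      simp [hκ₃] <;> ring
  · ext i
    fin_cases i <;> simp [Matrix.mulVec, dotProduct, Fin.sum_univ_four]
  · simp [h.S_zero, h.C_zero, h'.S_zero, h'.C_zero]
  · interval_cases i <;> ext i <;> fin_cases i <;>
      simp [Matrix.mulVec, dotProduct, Fin.sum_univ_four] <;> first | ring1 | skip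
    · linear_combination -μ ^ 4 * hη
    · linear_combination -ν ^ 4 * hε
  · constructor <;> simp [sympForm_eq]
    · linear_combination (ε * η * ε) * ha - η * hb + η * r * hε
    · linear_combination (ε * η * ν ^ 2) * ha - μ ^ 2 * hb - hr
    · linear_combination -η * ε * ν ^ 5 * a ^ 2 * hε + μ ^ 5 * b ^ 2 * hη
        - ε * η * ν ^ 2 * ha + μ ^ 2 * hb + hr
    · linear_combination ν ^ 7 * η * a ^ 2 * hε + η * ν ^ 4 * ha - η * μ ^ 4 * hb
        - (ε * ν ^ 2 + η * μ ^ 2) * hr - hκ₃ - η * r * ν ^ 4 * hε - r * ε * μ ^ 2 * ν ^ 2 * hη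

/-- Case II. The double root `0` of `π` and the extra factor `λ` give a nilpotent block on `1, s,
s²/2`. Thus `π(N) ≠ 0`, and only `N π(N)` vanishes. The constants satisfy `Λ(γ', γ'') = ε(e - b²μ³)
= 0` and `Λ(γ'', γ''') = b²μ⁵ = eμ² = 1`. -/
theorem isNormalForm_of_zero_frequency {ε : ℝ} {S C : ℝ → ℝ} (h : IsTrigPair ε S C)
    {μ b e κ₃ κ₄ : ℝ} (hb : b ^ 2 * μ ^ 3 = e) (he : e * μ ^ 2 = 1)
    (hκ₃ : κ₃ = -(ε * μ ^ 2)) (hκ₄ : κ₄ = κ₃ ^ 2) :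
    IsNormalForm κ₃ κ₄ fun s => ![s, b * C (μ * s), ε * e * (s ^ 2 / 2), b * S (μ * s)] := by
  have hε := h.sq
  refine isNormalForm_of_linear (n := 5)
    (φ := fun s => ![1, s, s ^ 2 / 2, C (μ * s), S (μ * s)])
    !![0, 0, 0, 0, 0; 1, 0, 0, 0, 0; 0, 1, 0, 0, 0; 0, 0, 0, 0, ε * μ; 0, 0, 0, μ, 0]
    !![0, 0, 0, 0, 0; 0, 0, 0, 0, 0; 1, 0, 0, 0, 0; 0, 0, 0, ε * μ ^ 2, 0; 0, 0, 0, 0, ε * μ ^ 2]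
    !![0, 1, 0, 0, 0; 0, 0, 0, b, 0; 0, 0, ε * e, 0, 0; 0, 0, 0, 0, b]
    (fun i => match i with
      | 0 => ![1, 0, 0, 1, 0]
      | 1 => ![0, 1, 0, 0, μ]
      | 2 => ![0, 0, 1, ε * μ ^ 2, 0]
      | 3 => ![0, 0, 0, 0, ε * μ ^ 3]
      | _ => ![0, 0, 0, μ ^ 4, 0])
    (fun s i => ?_) ?_ ?_ (fun s => ?_) ?_ (fun i hi => ?_) ?_
  · fin_cases i
    · exact (hasDerivAt_const s (1 : ℝ)).congr_deriv (by simp)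
    · exact (hasDerivAt_id s).congr_deriv (by simp)
    · exact (((hasDerivAt_id s).pow 2).div_const 2).congr_deriv (by simp)
    · exact (h.hasDerivAt_C μ s).congr_deriv (by simp [mul_comm])
    · exact (h.hasDerivAt_S μ s).congr_deriv (by simp [mul_comm])
  · ext i j
    fin_cases i <;> fin_cases j <;> simp [Matrix.mul_apply, Fin.sum_univ_five] <;> ring
  · rw [hκ₄, sub_self, zero_smul, add_zero]
    ext i j
    fin_cases i <;> fin_cases j <;>
      simp [Matrix.mul_apply, Fin.sum_univ_five, hκ₃]
  · ext i
    fin_cases i <;> simp [Matrix.mulVec, dotProduct, Fin.sum_univ_five]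
  · simp [h.S_zero, h.C_zero]
  · interval_cases i <;> ext i <;> fin_cases i <;>
      simp [Matrix.mulVec, dotProduct, Fin.sum_univ_five] <;> first | ring1 | skip
    · linear_combination -μ ^ 4 * hε
  · constructor <;> simp [sympForm_eq]
    · linear_combination -ε * hb
    · linear_combination μ ^ 2 * hb + he
    · linear_combination μ ^ 5 * b ^ 2 * hε + μ ^ 2 * hb + he
    · linear_combination -ε * μ ^ 4 * hb - ε * μ ^ 2 * he - hκ₃

/-- Case III: `π(λ) = (λ² - εμ²)²`, and the double roots bring in the resonant functions `s C(μs)`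
and `s S(μs)`. -/
theorem isNormalForm_of_double_frequency {ε : ℝ} {S C : ℝ → ℝ} (h : IsTrigPair ε S C)
    {μ κ₃ κ₄ : ℝ} (hμ : μ ≠ 0) (hκ₃ : κ₃ = -(2 * ε * μ ^ 2)) (hκ₄ : 4 * κ₄ = 3 * κ₃ ^ 2) :
    IsNormalForm κ₃ κ₄ fun s =>
      ![s * C (μ * s) / μ ^ 2, s * S (μ * s) / μ - ε * (3 * C (μ * s) / μ ^ 2),
        -(1 / 2) * (C (μ * s) / μ ^ 2), ε * (1 / 2 * (S (μ * s) / μ ^ 3))] := by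
  have hε := h.sq
  have hc : κ₃ ^ 2 - κ₄ = ε ^ 2 * μ ^ 4 := by
    rw [hκ₃] at hκ₄ ⊢
    linear_combination -1 / 4 * hκ₄
  refine isNormalForm_of_linear (n := 4)
    (φ := fun s => ![C (μ * s), S (μ * s), s * C (μ * s), s * S (μ * s)])
    !![0, ε * μ, 0, 0; μ, 0, 0, 0; 1, 0, 0, ε * μ; 0, 1, μ, 0]
    !![ε * μ ^ 2, 0, 0, 0; 0, ε * μ ^ 2, 0, 0; 0, 2 * ε * μ, ε * μ ^ 2, 0; 2 * μ, 0, 0, ε * μ ^ 2]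
    !![0, 0, 1 / μ ^ 2, 0; -ε * (3 / μ ^ 2), 0, 0, 1 / μ; -(1 / 2) / μ ^ 2, 0, 0, 0;
      0, ε * (1 / 2) / μ ^ 3, 0, 0]
    (fun i => match i with
      | 0 => ![1, 0, 0, 0]
      | 1 => ![0, μ, 1, 0]
      | 2 => ![ε * μ ^ 2, 0, 0, 2 * μ]
      | 3 => ![0, ε * μ ^ 3, 3 * ε * μ ^ 2, 0]
      | _ => ![μ ^ 4, 0, 0, 4 * ε * μ ^ 3])
    (fun s i => ?_) ?_ ?_ (fun s => ?_) ?_ (fun i hi => ?_) ?_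
  · fin_cases i
    · exact (h.hasDerivAt_C μ s).congr_deriv (by simp [mul_comm])
    · exact (h.hasDerivAt_S μ s).congr_deriv (by simp [mul_comm])
    · exact ((hasDerivAt_id s).mul (h.hasDerivAt_C μ s)).congr_deriv (by
        simp [Matrix.mulVec, dotProduct, Fin.sum_univ_four]; ring)
    · exact ((hasDerivAt_id s).mul (h.hasDerivAt_S μ s)).congr_deriv (by
        simp [Matrix.mulVec, dotProduct, Fin.sum_univ_four]; ring)
  · ext i j
    fin_cases i <;> fin_cases j <;> simp [Matrix.mul_apply, Fin.sum_univ_four] <;> ring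
  · rw [hc]
    convert Matrix.mul_zero _
    ext i j
    fin_cases i <;> fin_cases j <;>
      simp [hκ₃] <;> ring
  · ext i
    fin_cases i <;> simp [Matrix.mulVec, dotProduct, Fin.sum_univ_four] <;> ring
  · simp [h.S_zero, h.C_zero]
  · interval_cases i <;> ext i <;> fin_cases i <;>
      simp [Matrix.mulVec, dotProduct, Fin.sum_univ_four] <;> first | ring1 | skip
    · linear_combination -μ ^ 4 * hε
  · constructor <;> simp [sympForm_eq] <;>
      field_simp
    · linear_combination 3 * ε * hε
    · linear_combination -hε
    · linear_combination (-3 * ε ^ 2 + 2) * hε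
    · linear_combination -2 * hκ₃ - ε * μ ^ 2 * hε

/-- The products of `cos, sin` with `cosh, sinh` span the solutions with exponents `±μ ± iν`. The
coordinates of the `k`-th derivative of `φ` at `0` are the real part of `(μ + iν)ᵏ` on the cosine
products and the imaginary part on the sine products. -/
theorem curveI1'_isNormalForm {μ ν κ₃ κ₄ : ℝ} (hμ : 0 < μ) (hν : 0 < ν)
    (hκ₃ : κ₃ = 2 * (ν ^ 2 - μ ^ 2)) (hκ₄ : κ₃ ^ 2 - κ₄ = (μ ^ 2 + ν ^ 2) ^ 2) :
    IsNormalForm κ₃ κ₄ (curveI1' μ ν) := by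
  have h := isTrigPair_sin_cos
  have h' := isTrigPair_sinh_cosh
  have hq : μ ^ 2 + ν ^ 2 ≠ 0 := by positivity
  refine isNormalForm_of_linear (n := 4)
    (φ := fun s => ![Real.cos (ν * s) * Real.cosh (μ * s), Real.cos (ν * s) * Real.sinh (μ * s),
      Real.sin (ν * s) * Real.cosh (μ * s), Real.sin (ν * s) * Real.sinh (μ * s)])
    !![0, μ, -ν, 0; μ, 0, 0, -ν; ν, 0, 0, μ; 0, ν, μ, 0]
    !![μ ^ 2 - ν ^ 2, 0, 0, -2 * μ * ν; 0, μ ^ 2 - ν ^ 2, -2 * μ * ν, 0;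
      0, 2 * μ * ν, μ ^ 2 - ν ^ 2, 0; 2 * μ * ν, 0, 0, μ ^ 2 - ν ^ 2]
    !![0, μ / (μ ^ 2 + ν ^ 2), 0, 0;
      (μ ^ 2 - 3 * ν ^ 2) / (2 * (μ ^ 2 + ν ^ 2) ^ 2 * ν ^ 2), 0, 0,
        (3 * μ ^ 2 - ν ^ 2) / (2 * (μ ^ 2 + ν ^ 2) ^ 2 * μ * ν);
      (3 * μ ^ 2 - ν ^ 2) / (2 * (μ ^ 2 + ν ^ 2) ^ 2 * μ ^ 2), 0, 0,
        (3 * ν ^ 2 - μ ^ 2) / (2 * (μ ^ 2 + ν ^ 2) ^ 2 * μ * ν);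
      0, 0, ν / (μ ^ 2 + ν ^ 2), 0]
    (fun i => match i with
      | 0 => ![1, 0, 0, 0]
      | 1 => ![0, μ, ν, 0]
      | 2 => ![μ ^ 2 - ν ^ 2, 0, 0, 2 * μ * ν]
      | 3 => ![0, μ * (μ ^ 2 - 3 * ν ^ 2), ν * (3 * μ ^ 2 - ν ^ 2), 0]
      | _ => ![(μ ^ 2 - ν ^ 2) ^ 2 - 4 * μ ^ 2 * ν ^ 2, 0, 0, 4 * (μ ^ 2 - ν ^ 2) * μ * ν])
    (fun s i => ?_) ?_ ?_ (fun s => ?_) ?_ (fun i hi => ?_) ?_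
  · fin_cases i
    · exact ((h.hasDerivAt_C ν s).mul (h'.hasDerivAt_C μ s)).congr_deriv (by
        simp [Matrix.mulVec, dotProduct, Fin.sum_univ_four]; ring)
    · exact ((h.hasDerivAt_C ν s).mul (h'.hasDerivAt_S μ s)).congr_deriv (by
        simp [Matrix.mulVec, dotProduct, Fin.sum_univ_four]; ring)
    · exact ((h.hasDerivAt_S ν s).mul (h'.hasDerivAt_C μ s)).congr_deriv (by
        simp [Matrix.mulVec, dotProduct, Fin.sum_univ_four]; ring)
    · exact ((h.hasDerivAt_S ν s).mul (h'.hasDerivAt_S μ s)).congr_deriv (by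
        simp [Matrix.mulVec, dotProduct, Fin.sum_univ_four]; ring)
  · ext i j
    fin_cases i <;> fin_cases j <;> simp [Matrix.mul_apply, Fin.sum_univ_four] <;> ring
  · rw [hκ₄]
    convert Matrix.mul_zero _
    ext i j
    fin_cases i <;> fin_cases j <;>
      simp [hκ₃] <;> ring
  · ext i
    fin_cases i <;> simp [curveI1', Matrix.mulVec, dotProduct, Fin.sum_univ_four] <;> ring
  · simp
  · interval_cases i <;> ext i <;> fin_cases i <;>
      simp [Matrix.mulVec, dotProduct, Fin.sum_univ_four] <;> ring
  · constructor <;> simp [sympForm_eq, hκ₃] <;>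
      field_simp <;> ring

/-- Here `N π(N) = N⁵` with `N` nilpotent on polynomials of degree at most four. The constants
normalize `Λ(γ', γ'''') = -24/24` and `Λ(γ'', γ''') = 12/12`. -/
theorem curveIV_isNormalForm : IsNormalForm 0 0 curveIV := by
  have h24 : √24 ≠ (0 : ℝ) := by positivity
  have h12 : √12 ≠ (0 : ℝ) := by positivity
  have e24 : √24 ^ 2 = (24 : ℝ) := Real.sq_sqrt (by norm_num)
  have e12 : √12 ^ 2 = (12 : ℝ) := Real.sq_sqrt (by norm_num)
  refine isNormalForm_of_linear (n := 5)
    (φ := fun s => ![1, s, s ^ 2, s ^ 3, s ^ 4])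
    !![0, 0, 0, 0, 0; 1, 0, 0, 0, 0; 0, 2, 0, 0, 0; 0, 0, 3, 0, 0; 0, 0, 0, 4, 0]
    !![0, 0, 0, 0, 0; 0, 0, 0, 0, 0; 2, 0, 0, 0, 0; 0, 6, 0, 0, 0; 0, 0, 12, 0, 0]
    !![0, 1 / √24, 0, 0, 0; 0, 0, 1 / √12, 0, 0; 0, 0, 0, 0, -1 / √24; 0, 0, 0, 1 / √12, 0]
    (fun i => match i with
      | 0 => ![1, 0, 0, 0, 0]
      | 1 => ![0, 1, 0, 0, 0]
      | 2 => ![0, 0, 2, 0, 0]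
      | 3 => ![0, 0, 0, 6, 0]
      | _ => ![0, 0, 0, 0, 24])
    (fun s i => ?_) ?_ ?_ (fun s => ?_) ?_ (fun i hi => ?_) ?_
  · fin_cases i
    · exact (hasDerivAt_const s (1 : ℝ)).congr_deriv (by simp)
    · exact (hasDerivAt_id s).congr_deriv (by simp)
    · exact ((hasDerivAt_id s).pow 2).congr_deriv (by simp [mul_comm])
    · exact ((hasDerivAt_id s).pow 3).congr_deriv (by simp [mul_comm])
    · exact ((hasDerivAt_id s).pow 4).congr_deriv (by simp [mul_comm])
  · ext i j
    fin_cases i <;> fin_cases j <;> simp [Matrix.mul_apply, Fin.sum_univ_five] <;> norm_num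
  · simp
    ext i j
    fin_cases i <;> fin_cases j <;> simp
  · ext i
    fin_cases i <;> simp [curveIV, Matrix.mulVec, dotProduct, Fin.sum_univ_five] <;> ring
  · simp
  · interval_cases i <;> ext i <;> fin_cases i <;>
      simp [Matrix.mulVec, dotProduct, Fin.sum_univ_five] <;> norm_num
  · constructor <;> simp [sympForm_eq]
    · field_simp
      linear_combination e24
    · field_simp
      linear_combination -e12

/-! ### Amplitudes and the individual normal forms -/

theorem rpow_three_halves_sq {x : ℝ} (hx : 0 < x) : (x ^ (3 / 2 : ℝ)) ^ 2 = x ^ 3 := by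
  rw [← Real.rpow_natCast, ← Real.rpow_mul hx.le, ← Real.rpow_natCast]
  norm_num

theorem rpow_five_halves_sq {x : ℝ} (hx : 0 < x) : (x ^ (5 / 2 : ℝ)) ^ 2 = x ^ 5 := by
  rw [← Real.rpow_natCast, ← Real.rpow_mul hx.le, ← Real.rpow_natCast]
  norm_num

/-- Provides the common value `r = 1 / d` of `a²ν³` and `b²μ³`, where `d` is `μ² - ν²` or `μ² + ν²`.
-/
theorem one_div_sqrt_mul_rpow_sq {d x : ℝ} (hd : 0 < d) (hx : 0 < x) :
    (1 / (√d * x ^ (3 / 2 : ℝ))) ^ 2 * x ^ 3 = 1 / d := by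
  rw [div_pow, mul_pow, Real.sq_sqrt hd.le, rpow_three_halves_sq hx]
  field_simp

theorem one_div_rpow_sq {x : ℝ} (hx : 0 < x) :
    (1 / x ^ (5 / 2 : ℝ)) ^ 2 * x ^ 3 = 1 / x ^ 2 := by
  rw [div_pow, rpow_five_halves_sq hx]
  field_simp

theorem curveI2a_isNormalForm {μ ν κ₃ κ₄ : ℝ} (hν : 0 < ν) (hμ : ν < μ)
    (hκ₃ : κ₃ = -(μ ^ 2 + ν ^ 2)) (hκ₄ : κ₃ ^ 2 - κ₄ = μ ^ 2 * ν ^ 2) :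
    IsNormalForm κ₃ κ₄ (curveI2a μ ν) := by
  have hd : 0 < μ ^ 2 - ν ^ 2 := by nlinarith
  convert isNormalForm_of_two_frequencies isTrigPair_sinh_cosh isTrigPair_sinh_cosh
    (one_div_sqrt_mul_rpow_sq hd hν) (one_div_sqrt_mul_rpow_sq hd (hν.trans hμ))
    (by field_simp) (κ₃ := κ₃) (κ₄ := κ₄) (by rw [hκ₃]; ring) (by rw [hκ₄]; ring) using 1
  ext s i
  fin_cases i <;> simp [curveI2a] <;> ring

theorem curveI2b_isNormalForm {μ ν κ₃ κ₄ : ℝ} (hν : 0 < ν) (hμ : ν < μ)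
    (hκ₃ : κ₃ = μ ^ 2 + ν ^ 2) (hκ₄ : κ₃ ^ 2 - κ₄ = μ ^ 2 * ν ^ 2) :
    IsNormalForm κ₃ κ₄ (curveI2b μ ν) := by
  have hd : 0 < μ ^ 2 - ν ^ 2 := by nlinarith
  convert isNormalForm_of_two_frequencies isTrigPair_sin_cos isTrigPair_sin_cos
    (one_div_sqrt_mul_rpow_sq hd hν) (one_div_sqrt_mul_rpow_sq hd (hν.trans hμ))
    (by field_simp) (κ₃ := κ₃) (κ₄ := κ₄) (by rw [hκ₃]; ring) (by rw [hκ₄]; ring) using 1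
  ext s i
  fin_cases i <;> simp [curveI2b] <;> ring

theorem curveI2c_isNormalForm {μ ν κ₃ κ₄ : ℝ} (hμ : 0 < μ) (hν : 0 < ν)
    (hκ₃ : κ₃ = μ ^ 2 - ν ^ 2) (hκ₄ : κ₃ ^ 2 - κ₄ = -(μ ^ 2 * ν ^ 2)) :
    IsNormalForm κ₃ κ₄ (curveI2c μ ν) := by
  have hd : 0 < μ ^ 2 + ν ^ 2 := by positivity
  convert isNormalForm_of_two_frequencies isTrigPair_sinh_cosh isTrigPair_sin_cos
    (one_div_sqrt_mul_rpow_sq hd hν) (one_div_sqrt_mul_rpow_sq hd hμ)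
    (by field_simp; ring) (κ₃ := κ₃) (κ₄ := κ₄) (by rw [hκ₃]; ring) (by rw [hκ₄]; ring) using 1
  ext s i
  fin_cases i <;> simp [curveI2c] <;> ring

theorem curveII1_isNormalForm {μ κ₃ κ₄ : ℝ} (hμ : 0 < μ) (hκ₃ : κ₃ = -μ ^ 2)
    (hκ₄ : κ₄ = κ₃ ^ 2) : IsNormalForm κ₃ κ₄ (curveII1 μ) := by
  convert isNormalForm_of_zero_frequency isTrigPair_sinh_cosh (one_div_rpow_sq hμ)
    (by field_simp) (κ₃ := κ₃) (by rw [hκ₃]; ring) hκ₄ using 1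
  ext s i
  fin_cases i <;> simp [curveII1] <;> ring

theorem curveII2_isNormalForm {μ κ₃ κ₄ : ℝ} (hμ : 0 < μ) (hκ₃ : κ₃ = μ ^ 2)
    (hκ₄ : κ₄ = κ₃ ^ 2) : IsNormalForm κ₃ κ₄ (curveII2 μ) := by
  convert isNormalForm_of_zero_frequency isTrigPair_sin_cos (one_div_rpow_sq hμ)
    (by field_simp) (κ₃ := κ₃) (by rw [hκ₃]; ring) hκ₄ using 1
  ext s i
  fin_cases i <;> simp [curveII2] <;> ring

theorem curveIII1_isNormalForm {μ κ₃ κ₄ : ℝ} (hμ : 0 < μ) (hκ₃ : κ₃ = 2 * μ ^ 2)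
    (hκ₄ : 4 * κ₄ = 3 * κ₃ ^ 2) : IsNormalForm κ₃ κ₄ (curveIII1 μ) := by
  convert isNormalForm_of_double_frequency isTrigPair_sin_cos hμ.ne' (κ₃ := κ₃)
    (by rw [hκ₃]; ring) hκ₄ using 1
  ext s i
  fin_cases i <;> simp [curveIII1]

theorem curveIII2_isNormalForm {μ κ₃ κ₄ : ℝ} (hμ : 0 < μ) (hκ₃ : κ₃ = -(2 * μ ^ 2))
    (hκ₄ : 4 * κ₄ = 3 * κ₃ ^ 2) : IsNormalForm κ₃ κ₄ (curveIII2 μ) := by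
  convert isNormalForm_of_double_frequency isTrigPair_sinh_cosh hμ.ne' (κ₃ := κ₃)
    (by rw [hκ₃]; ring) hκ₄ using 1
  ext s i
  fin_cases i <;> simp [curveIII2]

/-- Coordinates `0, 2` and `1, 3` are dual, so rescaling each pair by reciprocal factors is
symplectic. The excluded parameters are those for which a factor vanishes. -/
theorem curveI1_isNormalForm {μ ν κ₃ κ₄ : ℝ} (hμ : 0 < μ) (hν : 0 < ν)
    (h : IsNormalForm κ₃ κ₄ (curveI1' μ ν)) (h1 : μ ^ 2 ≠ 3 * ν ^ 2) (h2 : ν ^ 2 ≠ 3 * μ ^ 2) :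
    IsNormalForm κ₃ κ₄ (curveI1 μ ν) := by
  have ha : μ ^ 2 - 3 * ν ^ 2 ≠ 0 := sub_ne_zero.2 h1
  have hb : ν ^ 2 - 3 * μ ^ 2 ≠ 0 := sub_ne_zero.2 h2
  have e1 : 3 * μ ^ 2 - ν ^ 2 = -(ν ^ 2 - 3 * μ ^ 2) := by ring
  have e2 : 3 * ν ^ 2 - μ ^ 2 = -(μ ^ 2 - 3 * ν ^ 2) := by ring
  have e3 : (3 * μ ^ 2 - ν ^ 2) * (ν ^ 2 - 3 * μ ^ 2)⁻¹ = -1 := by rw [e1]; field_simp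
  obtain ⟨g, hg, hgA⟩ := exists_affineSymplectic 0 (A := Matrix.diagonal
    ![μ ^ 2 - 3 * ν ^ 2, (ν ^ 2 - 3 * μ ^ 2)⁻¹, (μ ^ 2 - 3 * ν ^ 2)⁻¹, ν ^ 2 - 3 * μ ^ 2]) (by
      ext i j
      fin_cases i <;> fin_cases j <;> simp [sympJ, ha, hb, e3])
  refine h.of_congruent hg fun s => ?_
  rw [hgA, affineAct_blockMatrix, add_zero]
  ext i
  fin_cases i <;> simp [curveI1, curveI1', Matrix.mulVec_diagonal] <;> (try simp only [e1, e2]) <;>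
    generalize μ ^ 2 - 3 * ν ^ 2 = a at ha ⊢ <;> generalize ν ^ 2 - 3 * μ ^ 2 = b at hb ⊢
  · ring
  · field_simp
  · field_simp
  · ring

/-! ### Roots and cases -/

/-- Vieta: the four hypotheses compare the coefficients of `π` with the elementary symmetric
functions, so `π` splits with these roots. -/
theorem quarticRoots_eq {κ₃ κ₄ : ℝ} {a b c d : ℂ} (h1 : a + b + c + d = 0)
    (h2 : a * b + a * c + a * d + b * c + b * d + c * d = κ₃)
    (h3 : a * b * c + a * b * d + a * c * d + b * c * d = 0)
    (h4 : a * b * c * d = (κ₃ ^ 2 - κ₄ : ℝ)) : quarticRoots κ₃ κ₄ = {a, b, c, d} := by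
  have e : (quarticPoly κ₃ κ₄).map (algebraMap ℝ ℂ) =
      (({a, b, c, d} : Multiset ℂ).map fun r => Polynomial.X - Polynomial.C r).prod := by
    simp only [quarticPoly, Polynomial.map_add, Polynomial.map_mul, Polynomial.map_pow,
      Polynomial.map_X, Polynomial.map_C, Complex.coe_algebraMap, Multiset.insert_eq_cons,
      Multiset.map_cons, Multiset.map_singleton, Multiset.prod_cons, Multiset.prod_singleton]
    rw [← h2, ← h4]
    have h1 := congrArg (Polynomial.C (R := ℂ)) h1
    have h3 := congrArg (Polynomial.C (R := ℂ)) h3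
    simp only [map_add, map_mul, map_zero] at h1 h3 ⊢
    linear_combination Polynomial.X ^ 3 * h1 + Polynomial.X * h3
  rw [quarticRoots, e, Polynomial.roots_multiset_prod_X_sub_C]

/-- Write `δ² = 4κ₄ - 3κ₃²` when this is positive. Then `κ₃ = ±δ` would mean `κ₄ = κ₃²`, so outside
case II the position of `κ₃` relative to `-δ` and `δ` is strict. Both `κ₄ = κ₃²` and `4κ₄ = 3κ₃²`
hold only at the origin, which is case IV. -/
theorem existsUnique_curveType (κ₃ κ₄ : ℝ) : ∃! T : CurveType, T.Condition κ₃ κ₄ := by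
  have hprod : (κ₃ ^ 2 - κ₄) * (4 * κ₄ - 3 * κ₃ ^ 2) ≠ 0 ↔ κ₄ ≠ κ₃ ^ 2 ∧ 4 * κ₄ ≠ 3 * κ₃ ^ 2 := by
    rw [mul_ne_zero_iff, sub_ne_zero, sub_ne_zero, ne_comm]
  have hδ0 := Real.sqrt_nonneg (4 * κ₄ - 3 * κ₃ ^ 2)
  have hsq : 3 * κ₃ ^ 2 < 4 * κ₄ → √(4 * κ₄ - 3 * κ₃ ^ 2) ^ 2 = 4 * κ₄ - 3 * κ₃ ^ 2 :=
    fun h => Real.sq_sqrt (by linarith)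
  have hpos : 3 * κ₃ ^ 2 < 4 * κ₄ → 0 < √(4 * κ₄ - 3 * κ₃ ^ 2) :=
    fun h => Real.sqrt_pos.2 (by linarith)
  have hz : κ₄ = κ₃ ^ 2 → 4 * κ₄ = 3 * κ₃ ^ 2 → κ₃ = 0 := fun h h' => by
    have : κ₃ ^ 2 = 0 := by linarith
    exact pow_eq_zero_iff (two_ne_zero) |>.1 this
  refine existsUnique_of_exists_of_unique ?_ ?_
  · by_cases h2 : κ₄ = κ₃ ^ 2
    · rcases lt_trichotomy κ₃ 0 with h | h | h
      · exact ⟨.II1, h2, h⟩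
      · exact ⟨.IV, h, by rw [h2, h]; norm_num⟩
      · exact ⟨.II2, h2, h⟩
    rcases lt_trichotomy (4 * κ₄) (3 * κ₃ ^ 2) with h3 | h3 | h3
    · exact ⟨.I1, hprod.2 ⟨h2, h3.ne⟩, h3⟩
    · rcases lt_trichotomy κ₃ 0 with h | h | h
      · exact ⟨.III2, h3, h⟩
      · exact absurd (by rw [h] at h3 ⊢; linarith) h2
      · exact ⟨.III1, h3, h⟩
    · have hp := hprod.2 ⟨h2, h3.ne'⟩
      have hs := hsq h3
      have hp' := hpos h3
      generalize hδ : √(4 * κ₄ - 3 * κ₃ ^ 2) = δ at hs hp' hδ0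
      rcases lt_trichotomy κ₃ (-δ) with h | h | h
      · exact ⟨.I2a, hp, h3, by rw [hδ]; linarith, by rw [hδ]; linarith⟩
      · exact absurd (by rw [h] at hs ⊢; linarith) h2
      rcases lt_trichotomy κ₃ δ with h' | h' | h'
      · exact ⟨.I2c, hp, h3, by rw [hδ]; linarith, by rw [hδ]; linarith⟩
      · exact absurd (by rw [h'] at hs ⊢; linarith) h2
      · exact ⟨.I2b, hp, h3, by rw [hδ]; linarith, by rw [hδ]; linarith⟩
  · intro S T hS hT
    cases S <;> cases T <;> first | rfl | skip
    all_goals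
      exfalso
      simp only [CurveType.Condition, hprod] at hS hT
      grind

theorem exists_sq_eq {x : ℝ} (hx : 0 < x) : ∃ y, 0 < y ∧ y ^ 2 = x :=
  ⟨√x, Real.sqrt_pos.2 hx, Real.sq_sqrt hx.le⟩

/-- If `±μ ± iν` are the roots, then `q = √(κ₃² - κ₄)` is `μ² + ν²` and `κ₃ / 2` is `ν² - μ²`; solve
for the squares. The inequality `|κ₃ / 2| < q` is exactly `4κ₄ < 3κ₃²`. -/
theorem exists_frequencies_I1 {κ₃ κ₄ : ℝ} (h : CurveType.I1.Condition κ₃ κ₄) :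
    ∃ μ ν : ℝ, 0 < μ ∧ 0 < ν ∧ κ₃ = 2 * (ν ^ 2 - μ ^ 2) ∧
      κ₃ ^ 2 - κ₄ = (μ ^ 2 + ν ^ 2) ^ 2 := by
  obtain ⟨-, h⟩ := h
  obtain ⟨q, hq, hq2⟩ := exists_sq_eq (x := κ₃ ^ 2 - κ₄) (by nlinarith)
  obtain ⟨h1, h2⟩ := abs_lt_of_sq_lt_sq' (show (κ₃ / 2) ^ 2 < q ^ 2 by nlinarith) hq.le
  obtain ⟨μ, hμ, hμ2⟩ := exists_sq_eq (x := (q - κ₃ / 2) / 2) (by linarith)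
  obtain ⟨ν, hν, hν2⟩ := exists_sq_eq (x := (q + κ₃ / 2) / 2) (by linarith)
  exact ⟨μ, ν, hμ, hν, by rw [hμ2, hν2]; ring, by rw [hμ2, hν2, ← hq2]; ring⟩

/-- The roots satisfy `λ² = (-κ₃ ± δ) / 2`. The position of `κ₃` relative to `±δ` decides the two
signs, and the frequencies are the square roots of the absolute values; the same holds in the next
two cases. -/
theorem exists_frequencies_I2a {κ₃ κ₄ : ℝ} (h : CurveType.I2a.Condition κ₃ κ₄) :
    ∃ μ ν : ℝ, 0 < ν ∧ ν < μ ∧ κ₃ = -(μ ^ 2 + ν ^ 2) ∧ κ₃ ^ 2 - κ₄ = μ ^ 2 * ν ^ 2 := by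
  obtain ⟨-, h, -, h'⟩ := h
  have hδ := Real.sqrt_pos.2 (show 0 < 4 * κ₄ - 3 * κ₃ ^ 2 by linarith)
  have hδ2 := Real.sq_sqrt (show 0 ≤ 4 * κ₄ - 3 * κ₃ ^ 2 by linarith)
  generalize √(4 * κ₄ - 3 * κ₃ ^ 2) = δ at *
  obtain ⟨μ, hμ, hμ2⟩ := exists_sq_eq (x := (-κ₃ + δ) / 2) (by linarith)
  obtain ⟨ν, hν, hν2⟩ := exists_sq_eq (x := (-κ₃ - δ) / 2) (by linarith)
  exact ⟨μ, ν, hν, lt_of_pow_lt_pow_left₀ 2 hμ.le (by linarith), by rw [hμ2, hν2]; ring,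
    by rw [hμ2, hν2]; linear_combination hδ2 / 4⟩

theorem exists_frequencies_I2b {κ₃ κ₄ : ℝ} (h : CurveType.I2b.Condition κ₃ κ₄) :
    ∃ μ ν : ℝ, 0 < ν ∧ ν < μ ∧ κ₃ = μ ^ 2 + ν ^ 2 ∧ κ₃ ^ 2 - κ₄ = μ ^ 2 * ν ^ 2 := by
  obtain ⟨-, h, h', -⟩ := h
  have hδ := Real.sqrt_pos.2 (show 0 < 4 * κ₄ - 3 * κ₃ ^ 2 by linarith)
  have hδ2 := Real.sq_sqrt (show 0 ≤ 4 * κ₄ - 3 * κ₃ ^ 2 by linarith)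
  generalize √(4 * κ₄ - 3 * κ₃ ^ 2) = δ at *
  obtain ⟨μ, hμ, hμ2⟩ := exists_sq_eq (x := (κ₃ + δ) / 2) (by linarith)
  obtain ⟨ν, hν, hν2⟩ := exists_sq_eq (x := (κ₃ - δ) / 2) (by linarith)
  exact ⟨μ, ν, hν, lt_of_pow_lt_pow_left₀ 2 hμ.le (by linarith), by rw [hμ2, hν2]; ring,
    by rw [hμ2, hν2]; linear_combination hδ2 / 4⟩

theorem exists_frequencies_I2c {κ₃ κ₄ : ℝ} (h : CurveType.I2c.Condition κ₃ κ₄) :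
    ∃ μ ν : ℝ, 0 < μ ∧ 0 < ν ∧ κ₃ = μ ^ 2 - ν ^ 2 ∧ κ₃ ^ 2 - κ₄ = -(μ ^ 2 * ν ^ 2) := by
  obtain ⟨-, h, h', h''⟩ := h
  have hδ2 := Real.sq_sqrt (show 0 ≤ 4 * κ₄ - 3 * κ₃ ^ 2 by linarith)
  generalize √(4 * κ₄ - 3 * κ₃ ^ 2) = δ at *
  obtain ⟨μ, hμ, hμ2⟩ := exists_sq_eq (x := (δ + κ₃) / 2) (by linarith)
  obtain ⟨ν, hν, hν2⟩ := exists_sq_eq (x := (δ - κ₃) / 2) (by linarith)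
  exact ⟨μ, ν, hμ, hν, by rw [hμ2, hν2]; ring,
    by rw [hμ2, hν2]; linear_combination hδ2 / 4⟩

/-! ### The torus group -/

theorem torusMatrix_mem_torusSubgroup (a b : ℝ) :
    ∃ g ∈ torusSubgroup, (g : Matrix (Fin 5) (Fin 5) ℝ) = torusMatrix a b :=
  ⟨⟨torusMatrix a b, torusMatrix (-a) (-b), by rw [torusMatrix_mul, add_neg_cancel,
    add_neg_cancel, torusMatrix_zero], by rw [torusMatrix_mul, neg_add_cancel,
    neg_add_cancel, torusMatrix_zero]⟩, ⟨a, b, rfl⟩, rfl⟩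

theorem torusSubgroup_le : torusSubgroup ≤ affineSymplecticGroup := by
  rintro g ⟨a, b, hg⟩
  obtain ⟨B, hB, hBg⟩ := exists_affineSymplectic 0 (A :=
    !![Real.cos a, 0, -Real.sin a, 0; 0, Real.cos b, 0, -Real.sin b;
      Real.sin a, 0, Real.cos a, 0; 0, Real.sin b, 0, Real.cos b]) (by
    have h1 := Real.sin_sq_add_cos_sq a
    have h2 := Real.sin_sq_add_cos_sq b
    ext i j
    fin_cases i <;> fin_cases j <;> simp [sympJ, Matrix.mul_apply, Fin.sum_univ_four] <;>
      linarith)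
  have : g = B := Units.ext <| by
    rw [hg, hBg]
    ext i j
    fin_cases i <;> fin_cases j <;> rfl
  rwa [this]

theorem torusSubgroup_comm : ∀ x ∈ torusSubgroup, ∀ y ∈ torusSubgroup, x * y = y * x := by
  rintro x ⟨a, b, hx⟩ y ⟨c, d, hy⟩
  refine Units.ext ?_
  rw [Units.val_mul, Units.val_mul, hx, hy, torusMatrix_mul, torusMatrix_mul, add_comm a,
    add_comm b]

theorem exists_angle {c s : ℝ} (h : c ^ 2 + s ^ 2 = 1) : ∃ θ, Real.cos θ = c ∧ Real.sin θ = s := by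
  have hn : ‖(⟨c, s⟩ : ℂ)‖ = 1 := by
    rw [← sq_eq_sq₀ (norm_nonneg _) zero_le_one, ← Complex.normSq_eq_norm_sq, Complex.normSq_mk]
    linarith
  refine ⟨Complex.arg ⟨c, s⟩, ?_, ?_⟩
  · rw [Complex.cos_arg (norm_ne_zero_iff.1 (by rw [hn]; exact one_ne_zero)), hn, div_one]
  · rw [Complex.sin_arg, hn, div_one]

/-- Commuting with the quarter turns `X(π/2, 0)` and `X(0, π/2)` kills the translation, preserves
the two coordinate planes and forces each block to have the shape `(c, -s; s, c)`. The symplectic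
condition then gives `c² + s² = 1`, a rotation. -/
theorem torusSubgroup_maximal (H : Subgroup (GL (Fin 5) ℝ)) (hH : H ≤ affineSymplecticGroup)
    (hc : ∀ x ∈ H, ∀ y ∈ H, x * y = y * x) (hT : torusSubgroup ≤ H) : H = torusSubgroup := by
  refine le_antisymm (fun h hh => ?_) hT
  obtain ⟨g₁, hg₁, hX₁⟩ := torusMatrix_mem_torusSubgroup (Real.pi / 2) 0
  obtain ⟨g₂, hg₂, hX₂⟩ := torusMatrix_mem_torusSubgroup 0 (Real.pi / 2)
  have e₁ := congrArg Units.val (hc h hh g₁ (hT hg₁))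
  have e₂ := congrArg Units.val (hc h hh g₂ (hT hg₂))
  have hJ := sympForm_columns (hH hh)
  obtain ⟨a, A, -, hA⟩ := hH hh
  have hrow : ∀ j, (h : Matrix (Fin 5) (Fin 5) ℝ) 0 j = (Fin.cons 1 0 : Fin 5 → ℝ) j := by
    rw [hA]
    exact fun j => rfl
  have hr := fun j : Fin 4 => hrow j.succ
  have h0 := hrow 0
  rw [Units.val_mul, Units.val_mul, hX₁] at e₁
  rw [Units.val_mul, Units.val_mul, hX₂] at e₂
  have f₁ := fun i j => congrFun (congrFun e₁ i) j
  have f₂ := fun i j => congrFun (congrFun e₂ i) j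
  have j13 := hJ 0 2
  have j24 := hJ 1 3
  simp only [sympForm_eq] at j13 j24
  generalize hM : (h : Matrix (Fin 5) (Fin 5) ℝ) = M at *
  simp [Fin.forall_fin_succ, torusMatrix, Matrix.mul_apply, Fin.sum_univ_five] at f₁ f₂ hr h0
  simp [sympJ] at j13 j24
  obtain ⟨⟨-, -⟩, ⟨p10, p13, p12, p11, p14⟩, ⟨p23, p23'⟩, ⟨p30, -, p32, -, p34⟩, p43, p43'⟩ := f₁
  obtain ⟨⟨-, -⟩, ⟨q14, q14'⟩, ⟨q20, q21, q24, -, q22⟩, ⟨q34, q34'⟩, q40, -, -, -, -⟩ := f₂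
  obtain ⟨r1, r2, r3, r4⟩ := hr
  have z12 : M 1 2 = 0 := by linarith
  have z21 : M 2 1 = 0 := by linarith
  have z41 : M 4 1 = 0 := by linarith
  have z32 : M 3 2 = 0 := by linarith
  rw [z21, z41, p13, ← p11] at j13
  rw [z12, z32, q24, ← q22] at j24
  obtain ⟨α, hα, hα'⟩ := exists_angle (c := M 1 1) (s := M 3 1) (by linarith)
  obtain ⟨β, hβ, hβ'⟩ := exists_angle (c := M 2 2) (s := M 4 2) (by linarith)
  refine ⟨α, β, ?_⟩
  rw [hM]
  ext i j
  fin_cases i <;> fin_cases j <;> simp [torusMatrix, hα, hα', hβ, hβ'] <;> linarith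

/-! ### Curves on tori -/

theorem torusMatrix_eq_blockMatrix (a b : ℝ) : torusMatrix a b = blockMatrix 1 0
    !![Real.cos a, 0, -Real.sin a, 0; 0, Real.cos b, 0, -Real.sin b;
      Real.sin a, 0, Real.cos a, 0; 0, Real.sin b, 0, Real.cos b] := by
  ext i j
  fin_cases i <;> fin_cases j <;> rfl

theorem torusGenerator_mem (μ ν : ℝ) : torusGenerator μ ν ∈ affineSymplecticAlgebra := by
  refine ⟨0, !![0, 0, ν, 0; 0, 0, 0, -μ; -ν, 0, 0, 0; 0, μ, 0, 0], ?_, ?_⟩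
  · ext i j
    fin_cases i <;> fin_cases j <;> simp [sympJ, Matrix.mul_apply, Fin.sum_univ_four]
  · ext i j
    fin_cases i <;> fin_cases j <;> rfl

/-- Both sides equal `1` at `s = 0` and solve `E' = E X`, so uniqueness applies. -/
theorem exp_smul_torusGenerator (μ ν s : ℝ) :
    NormedSpace.exp (s • torusGenerator μ ν) = torusMatrix (-(ν * s)) (μ * s) := by
  refine eq_exp_smul_of_hasDerivAt (E := fun s => torusMatrix (-(ν * s)) (μ * s))
    (by simp [torusMatrix_zero]) (fun s i j => ?_) s
  have hC := isTrigPair_sin_cos.hasDerivAt_C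
  have hS := isTrigPair_sin_cos.hasDerivAt_S
  fin_cases i <;> fin_cases j <;>
    simp [torusMatrix, torusGenerator, Matrix.mul_apply, Fin.sum_univ_five, hasDerivAt_const]
  all_goals first
    | exact (hC _ s).congr_deriv (by ring)
    | exact (hS _ s).congr_deriv (by ring)
    | exact (hS _ s).neg.congr_deriv (by ring)

theorem affineAct_torusMatrix (μ ν a b : ℝ) :
    affineAct (torusMatrix a b) (torusPoint μ ν) =
      ![-(Real.sin a * torusPoint μ ν 2), Real.cos b * torusPoint μ ν 1,
        Real.cos a * torusPoint μ ν 2, Real.sin b * torusPoint μ ν 1] := by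
  rw [torusMatrix_eq_blockMatrix, affineAct_blockMatrix, add_zero]
  ext i
  fin_cases i <;> simp [Matrix.mulVec, dotProduct, Fin.sum_univ_four, torusPoint]

theorem rpow_neg_half_eq {x d : ℝ} (hx : 0 < x) (hd : 0 < d) :
    (x ^ 3 * d) ^ (-1 / 2 : ℝ) = 1 / (√d * x ^ (3 / 2 : ℝ)) := by
  rw [Real.mul_rpow (by positivity) hd.le, ← Real.rpow_natCast, ← Real.rpow_mul hx.le,
    neg_div, Real.rpow_neg hd.le, ← Real.sqrt_eq_rpow, mul_comm,
    show ((3 : ℕ) : ℝ) * -(1 / 2) = -(3 / 2) by norm_num, Real.rpow_neg hx.le, one_div, mul_inv]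

theorem curveI2b_eq {μ ν : ℝ} (hν : 0 < ν) (hμ : ν < μ) (s : ℝ) :
    curveI2b μ ν s = affineAct (torusMatrix (-(ν * s)) (μ * s)) (torusPoint μ ν) := by
  have hd : 0 < μ ^ 2 - ν ^ 2 := by nlinarith
  rw [affineAct_torusMatrix]
  ext i
  fin_cases i <;>
    simp [curveI2b, torusPoint, rpow_neg_half_eq hν hd, rpow_neg_half_eq (hν.trans hμ) hd] <;> ring

theorem torusPoint_pos {μ ν : ℝ} (hν : 0 < ν) (hμ : ν < μ) :
    0 < torusPoint μ ν 1 ∧ 0 < torusPoint μ ν 2 := by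
  have hd : 0 < μ ^ 2 - ν ^ 2 := by nlinarith
  have h := hν.trans hμ
  exact ⟨Real.rpow_pos_of_pos (by positivity) _, Real.rpow_pos_of_pos (by positivity) _⟩

/-- The parametrization of the image of the torus `𝕋²_{μ,ν}` under an affine map. -/
noncomputable def torusChart (g : Matrix (Fin 5) (Fin 5) ℝ) (μ ν : ℝ) (x : ℝ × ℝ) : Fin 4 → ℝ :=
  affineAct g (affineAct (torusMatrix x.1 x.2) (torusPoint μ ν))

theorem range_torusChart (g : Matrix (Fin 5) (Fin 5) ℝ) (μ ν : ℝ) :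
    Set.range (torusChart g μ ν) = affineAct g '' torusOrbit μ ν := by
  ext x
  constructor
  · rintro ⟨y, rfl⟩
    obtain ⟨h, hh, he⟩ := torusMatrix_mem_torusSubgroup y.1 y.2
    exact ⟨_, ⟨h, hh, rfl⟩, by rw [he]; rfl⟩
  · rintro ⟨_, ⟨h, ⟨a, b, he⟩, rfl⟩, rfl⟩
    exact ⟨(a, b), by rw [he]; rfl⟩

theorem affineAct_injective {g : GL (Fin 5) ℝ} (hg : g ∈ affineSymplecticGroup) :
    Function.Injective (affineAct g) := by
  refine Function.LeftInverse.injective (g := affineAct (g⁻¹ : GL (Fin 5) ℝ)) fun x => ?_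
  rw [← affineAct_mul (inv_mem hg) hg, ← Units.val_mul, inv_mul_cancel, Units.val_one,
    ← blockMatrix_one, affineAct_blockMatrix, Matrix.one_mulVec, add_zero]

theorem cos_sin_eq_iff (a b : ℝ) : (Real.cos a = Real.cos b ∧ Real.sin a = Real.sin b) ↔
    ∃ m : ℤ, a = b + 2 * Real.pi * m := by
  constructor
  · rintro ⟨h1, h2⟩
    obtain ⟨k, hk⟩ := Real.Angle.angle_eq_iff_two_pi_dvd_sub.1 (Real.Angle.cos_sin_inj h1 h2)
    exact ⟨k, by linarith⟩
  · rintro ⟨m, rfl⟩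
    rw [mul_comm]
    exact ⟨Real.cos_add_int_mul_two_pi b m, Real.sin_add_int_mul_two_pi b m⟩

/-- The orbit is a product of two circles of positive radii, so a point determines the cosine and
sine of both angles. -/
theorem torusChart_eq_iff {g : GL (Fin 5) ℝ} (hg : g ∈ affineSymplecticGroup) {μ ν : ℝ}
    (hν : 0 < ν) (hμ : ν < μ) (x y : ℝ × ℝ) : torusChart g μ ν x = torusChart g μ ν y ↔
      ∃ m n : ℤ, x = y + (2 * Real.pi * m, 2 * Real.pi * n) := by
  obtain ⟨h1, h2⟩ := torusPoint_pos hν hμ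
  rw [torusChart, torusChart, (affineAct_injective hg).eq_iff, affineAct_torusMatrix,
    affineAct_torusMatrix]
  simp only [Prod.ext_iff, Prod.fst_add, Prod.snd_add, exists_and_left, exists_and_right,
    ← cos_sin_eq_iff]
  constructor
  · intro h
    have e0 := congrFun h 0
    have e1 := congrFun h 1
    have e2 := congrFun h 2
    have e3 := congrFun h 3
    simp [h1.ne', h2.ne'] at e0 e1 e2 e3
    exact ⟨⟨e2, e0⟩, e1, e3⟩
  · rintro ⟨⟨e2, e0⟩, e1, e3⟩
    rw [e0, e1, e2, e3]

theorem hasFDerivAt_torusChart {g : GL (Fin 5) ℝ} {a : Fin 4 → ℝ} {A : Matrix (Fin 4) (Fin 4) ℝ}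
    (hg : (g : Matrix (Fin 5) (Fin 5) ℝ) = blockMatrix 1 a A) (μ ν : ℝ) (x : ℝ × ℝ) :
    ∃ L : ℝ × ℝ →L[ℝ] Fin 4 → ℝ, HasFDerivAt (torusChart g μ ν) L x ∧ ∀ u, L u = A *ᵥ
      ![-(u.1 * (Real.cos x.1 * torusPoint μ ν 2)), -(u.2 * (Real.sin x.2 * torusPoint μ ν 1)),
        -(u.1 * (Real.sin x.1 * torusPoint μ ν 2)), u.2 * (Real.cos x.2 * torusPoint μ ν 1)] := by
  set r₁ := torusPoint μ ν 1 with hr₁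
  set r₂ := torusPoint μ ν 2 with hr₂
  let L' : Fin 4 → (ℝ × ℝ →L[ℝ] ℝ) := ![-((Real.cos x.1 * r₂) • ContinuousLinearMap.fst ℝ ℝ ℝ),
    -((Real.sin x.2 * r₁) • ContinuousLinearMap.snd ℝ ℝ ℝ),
    -((Real.sin x.1 * r₂) • ContinuousLinearMap.fst ℝ ℝ ℝ),
    (Real.cos x.2 * r₁) • ContinuousLinearMap.snd ℝ ℝ ℝ]
  have hL : HasFDerivAt (fun y : ℝ × ℝ => affineAct (torusMatrix y.1 y.2) (torusPoint μ ν))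
      (ContinuousLinearMap.pi L') x := by
    rw [hasFDerivAt_pi']
    have h1 : HasFDerivAt (fun y : ℝ × ℝ => y.1) (ContinuousLinearMap.fst ℝ ℝ ℝ) x := hasFDerivAt_fst
    have h2 : HasFDerivAt (fun y : ℝ × ℝ => y.2) (ContinuousLinearMap.snd ℝ ℝ ℝ) x := hasFDerivAt_snd
    simp only [affineAct_torusMatrix]
    intro i
    fin_cases i
    · exact ((h1.sin.mul_const r₂).neg).congr_fderiv (by ext <;> simp [L', mul_comm])
    · exact ((h2.cos.mul_const r₁)).congr_fderiv (by ext <;> simp [L', mul_comm])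
    · exact ((h1.cos.mul_const r₂)).congr_fderiv (by ext <;> simp [L', mul_comm])
    · exact ((h2.sin.mul_const r₁)).congr_fderiv (by ext <;> simp [L', mul_comm])
  let B : (Fin 4 → ℝ) →L[ℝ] (Fin 4 → ℝ) := LinearMap.toContinuousLinearMap A.mulVecLin
  refine ⟨B.comp (ContinuousLinearMap.pi L'), ?_, fun u => ?_⟩
  · have := (B.hasFDerivAt.comp x hL).add_const a
    have e : torusChart g μ ν = fun y => (B ∘ fun y : ℝ × ℝ =>
        affineAct (torusMatrix y.1 y.2) (torusPoint μ ν)) y + a := by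
      ext1 y
      rw [torusChart, hg, affineAct_blockMatrix]
      rfl
    rw [e]
    exact this
  · change A *ᵥ _ = A *ᵥ _
    congr 1
    ext i
    fin_cases i <;> simp [L', mul_comm]

theorem contDiff_torusChart {g : GL (Fin 5) ℝ} (hg : g ∈ affineSymplecticGroup) (μ ν : ℝ) :
    ContDiff ℝ ∞ (torusChart g μ ν) := by
  obtain ⟨a, A, -, hg⟩ := hg
  refine contDiff_pi.2 fun i => ?_
  simp only [torusChart, hg, affineAct_torusMatrix, affineAct_blockMatrix, Pi.add_apply,
    Matrix.mulVec, dotProduct, Fin.sum_univ_four]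
  simp
  fun_prop

theorem sympForm_mulVec {A : Matrix (Fin 4) (Fin 4) ℝ} (hA : Aᵀ * sympJ * A = sympJ)
    (x y : Fin 4 → ℝ) : sympForm (A *ᵥ x) (A *ᵥ y) = sympForm x y := by
  rw [sympForm, sympForm]
  conv_rhs => rw [← hA]
  rw [Matrix.dotProduct_mulVec, Matrix.dotProduct_mulVec, ← Matrix.vecMul_transpose,
    Matrix.dotProduct_mulVec]
  simp only [Matrix.vecMul_vecMul, Matrix.mul_assoc]

/-- The two circles lie in `Λ`-orthogonal planes, so the tangent vectors of one are orthogonal to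
those of the other, while each tangent line is isotropic. The linear part of `g` preserves `Λ`. -/
theorem isLagrangianTorus {g : GL (Fin 5) ℝ} (hg : g ∈ affineSymplecticGroup) {μ ν : ℝ}
    (hν : 0 < ν) (hμ : ν < μ) : IsLagrangianTorus (affineAct g '' torusOrbit μ ν) := by
  refine ⟨torusChart g μ ν, contDiff_torusChart hg μ ν, torusChart_eq_iff hg hν hμ, ?_, ?_,
    range_torusChart _ μ ν⟩ <;> obtain ⟨a, A, hA, hg⟩ := hg
  · intro x
    obtain ⟨h1, h2⟩ := torusPoint_pos hν hμ
    obtain ⟨L, hL, hLu⟩ := hasFDerivAt_torusChart hg μ ν x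
    rw [hL.fderiv]
    refine (injective_iff_map_eq_zero L).2 fun u hu => ?_
    rw [hLu] at hu
    have hv := congrArg (fun v => ((A⁻¹ : GL (Fin 4) ℝ) : Matrix (Fin 4) (Fin 4) ℝ) *ᵥ v) hu
    simp only [Matrix.mulVec_mulVec, ← Units.val_mul, inv_mul_cancel, Units.val_one,
      Matrix.one_mulVec, Matrix.mulVec_zero] at hv
    have e0 := congrFun hv 0
    have e1 := congrFun hv 1
    have e2 := congrFun hv 2
    have e3 := congrFun hv 3
    simp [h1.ne', h2.ne'] at e0 e1 e2 e3
    have s1 := Real.sin_sq_add_cos_sq x.1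
    have s2 := Real.sin_sq_add_cos_sq x.2
    refine Prod.ext ?_ ?_
    · rcases e0 with h | h
      · exact h
      · refine e2.resolve_right fun h' => ?_
        rw [h, h'] at s1
        norm_num at s1
    · rcases e1 with h | h
      · exact h
      · refine e3.resolve_right fun h' => ?_
        rw [h, h'] at s2
        norm_num at s2
  · intro x u v
    obtain ⟨L, hL, hLu⟩ := hasFDerivAt_torusChart hg μ ν x
    rw [hL.fderiv, hLu, hLu, sympForm_mulVec hA, sympForm_eq]
    simp
    ring

/-- The translated torus is the orbit of `g ⋆ p` under the conjugate group `g 𝕋² g⁻¹`. -/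
theorem isHomogeneousLagrangianTorus {g : GL (Fin 5) ℝ} (hg : g ∈ affineSymplecticGroup)
    {μ ν : ℝ} (hν : 0 < ν) (hμ : ν < μ) :
    IsHomogeneousLagrangianTorus (affineAct g '' torusOrbit μ ν) := by
  refine ⟨isLagrangianTorus hg hν hμ, torusSubgroup.map (MulAut.conj g).toMonoidHom, ?_,
    affineAct g (torusPoint μ ν), ?_⟩
  · rintro _ ⟨h, hh, rfl⟩
    exact mul_mem (mul_mem hg (torusSubgroup_le hh)) (inv_mem hg)
  · have key : ∀ h ∈ torusSubgroup, affineAct (((MulAut.conj g) h : GL (Fin 5) ℝ) :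
        Matrix (Fin 5) (Fin 5) ℝ) (affineAct g (torusPoint μ ν)) =
        affineAct g (affineAct h (torusPoint μ ν)) := fun h hh => by
      have hh := torusSubgroup_le hh
      rw [MulAut.conj_apply, ← affineAct_mul (mul_mem (mul_mem hg hh) (inv_mem hg)) hg,
        ← Units.val_mul, inv_mul_cancel_right, Units.val_mul, affineAct_mul hg hh]
    ext x
    constructor
    · rintro ⟨_, ⟨h, hh, rfl⟩, rfl⟩
      exact ⟨_, ⟨h, hh, rfl⟩, (key h hh).symm⟩
    · rintro ⟨_, ⟨h, hh, rfl⟩, rfl⟩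
      exact ⟨_, ⟨h, hh, rfl⟩, (key h hh).symm⟩

/-! ### Linear flows on the torus: periodic or dense -/

theorem isCompact_torus {g : GL (Fin 5) ℝ} (hg : g ∈ affineSymplecticGroup) {μ ν : ℝ}
    (hν : 0 < ν) (hμ : ν < μ) : IsCompact (Set.range (torusChart g μ ν)) := by
  have h := ((isCompact_Icc (a := (0 : ℝ)) (b := 2 * Real.pi)).prod
    (isCompact_Icc (a := (0 : ℝ)) (b := 2 * Real.pi))).image (contDiff_torusChart hg μ ν).continuous
  refine ((Set.image_subset_range _ _).antisymm (Set.range_subset_iff.2 fun x => ?_)) ▸ h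
  have p1 : Function.Periodic (fun t => torusChart g μ ν (t, x.2)) (2 * Real.pi) := fun t =>
    (torusChart_eq_iff hg hν hμ _ _).2 ⟨1, 0, by simp⟩
  obtain ⟨a, ha, hax⟩ := p1.exists_mem_Ico₀ Real.two_pi_pos x.1
  have p2 : Function.Periodic (fun t => torusChart g μ ν (a, t)) (2 * Real.pi) := fun t =>
    (torusChart_eq_iff hg hν hμ _ _).2 ⟨0, 1, by simp⟩
  obtain ⟨b, hb, hbx⟩ := p2.exists_mem_Ico₀ Real.two_pi_pos x.2
  exact ⟨(a, b), ⟨Set.Ico_subset_Icc_self ha, Set.Ico_subset_Icc_self hb⟩,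
    (hax.trans hbx).symm⟩

/-- A linear flow with irrational slope is dense in the torus. -/
theorem closure_range_of_irrational {g : GL (Fin 5) ℝ} (hg : g ∈ affineSymplecticGroup) {μ ν : ℝ}
    (hν : 0 < ν) (hμ : ν < μ) (h : Irrational (μ / ν)) :
    closure (Set.range fun s => torusChart g μ ν (-(ν * s), μ * s)) =
      Set.range (torusChart g μ ν) := by
  refine (closure_minimal ?_ (isCompact_torus hg hν hμ).isClosed).antisymm ?_
  · rintro _ ⟨s, rfl⟩
    exact ⟨_, rfl⟩
  rintro _ ⟨x, rfl⟩
  have hd : Dense (AddSubgroup.closure {2 * Real.pi * (μ / ν), 2 * Real.pi} : Set ℝ) := by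
    rw [dense_addSubgroupClosure_pair_iff, mul_div_cancel_left₀ _ Real.two_pi_pos.ne']
    exact h
  -- The circle on which the first angle is `x.1`. The flow meets it at the times `(2πm - x.1) / ν`,
  -- where `t = 2πmμ/ν` modulo `2π`; these values of `t` form the dense subgroup above.
  have hF : Continuous fun t => torusChart g μ ν (x.1, t - μ * x.1 / ν) :=
    (contDiff_torusChart hg μ ν).continuous.comp (by fun_prop)
  have := map_mem_closure hF (hd (x.2 + μ * x.1 / ν))
    (t := Set.range fun s => torusChart g μ ν (-(ν * s), μ * s)) (fun t ht => by
      obtain ⟨m, n, rfl⟩ := AddSubgroup.mem_closure_pair.1 ht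
      refine ⟨(2 * Real.pi * m - x.1) / ν, (torusChart_eq_iff hg hν hμ _ _).2 ⟨-m, -n, ?_⟩⟩
      ext
      · simp
        field_simp
        ring
      · simp
        field_simp
        ring)
  simpa using this

/-- A linear flow with rational slope is a simple closed curve. -/
theorem simple_closed_of_rational {g : GL (Fin 5) ℝ} (hg : g ∈ affineSymplecticGroup) {μ ν : ℝ}
    (hν : 0 < ν) (hμ : ν < μ) (h : ¬ Irrational (μ / ν)) :
    ∃ T > 0, Function.Periodic (fun s => torusChart g μ ν (-(ν * s), μ * s)) T ∧
      Set.InjOn (fun s => torusChart g μ ν (-(ν * s), μ * s)) (Set.Ico 0 T) := by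
  obtain ⟨r, hr⟩ : ∃ r : ℚ, (r : ℝ) = μ / ν := by
    simpa [Irrational] using h
  have hq : (0 : ℝ) < r.den := by exact_mod_cast r.den_pos
  have hr' : μ * r.den = ν * r.num := by
    rw [Rat.cast_def, div_eq_div_iff hq.ne' hν.ne'] at hr
    linarith
  have hT : 0 < 2 * Real.pi * r.den / ν := by positivity
  -- With `μ / ν = p / q` in lowest terms, in time `2πq / ν` the first angle makes `-q` full turns
  -- and the second `p`.
  refine ⟨2 * Real.pi * r.den / ν, hT, fun s => ?_, fun s hs t ht hst => ?_⟩
  · refine (torusChart_eq_iff hg hν hμ _ _).2 ⟨-r.den, r.num, ?_⟩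
    ext
    · simp
      field_simp
      ring
    · simp
      field_simp
      linear_combination 2 * Real.pi * hr'
  · obtain ⟨m, n, hmn⟩ := (torusChart_eq_iff hg hν hμ _ _).1 hst
    have e1 := congrArg Prod.fst hmn
    have e2 := congrArg Prod.snd hmn
    simp only [Prod.fst_add, Prod.snd_add] at e1 e2
    -- Returning to the same point means `ν(s - t) = -2πm` and `μ(s - t) = 2πn`, hence `nq = -mp`.
    -- By coprimality `q` divides `m`, so `s - t` is an integer multiple of the period, which must
    -- be zero on `[0, T)`.
    have e3 : (n * r.den : ℝ) = -m * r.num := by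
      have : 2 * Real.pi * ν * (n * r.den) = 2 * Real.pi * ν * (-m * r.num) := by
        linear_combination (-ν * r.den) * e2 + ν * (s - t) * hr' - ν * r.num * e1
      exact mul_left_cancel₀ (by positivity) this
    have e4 : n * (r.den : ℤ) = -m * r.num := by exact_mod_cast e3
    have hdvd : (r.den : ℤ) ∣ -m := by
      refine IsCoprime.dvd_of_dvd_mul_right (z := r.num) ?_ ⟨n, by rw [← e4, mul_comm]⟩
      exact r.isCoprime_num_den.symm
    obtain ⟨j, hj⟩ := hdvd
    have hj' : (-m : ℝ) = r.den * j := by exact_mod_cast hj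
    have e5 : s - t = 2 * Real.pi * r.den / ν * j := by
      field_simp
      linear_combination -e1 + 2 * Real.pi * hj'
    have b1 : s - t < 2 * Real.pi * r.den / ν := by linarith [hs.2, ht.1]
    have b2 : -(2 * Real.pi * r.den / ν) < s - t := by linarith [hs.1, ht.2]
    rw [e5] at b1 b2
    have c1 : (j : ℝ) < 1 := by nlinarith
    have c2 : (-1 : ℝ) < j := by nlinarith
    have : j = 0 := by
      have c1 : j < 1 := by exact_mod_cast c1
      have c2 : -1 < j := by exact_mod_cast c2
      omega
    rw [this] at e5
    simp at e5
    linarith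

/-! ### Assembly of the classification -/

theorem mainTheorem2 :
    -- the curves as first columns of `B exp(sA)`, and the orbit property
    (∀ κ₃ κ₄ : ℝ,
      frenetMatrix κ₃ κ₄ ∈ affineSymplecticAlgebra ∧
      (frenetMatrix κ₃ κ₄).charpoly = Polynomial.X * quarticPoly κ₃ κ₄ ∧
      ∀ (I : Set ℝ) (γ : ℝ → Fin 4 → ℝ), IsCurveDomain I →
        (HasConstantCurvatures γ I κ₃ κ₄ ↔
          ∃ B ∈ affineSymplecticGroup, ∀ s ∈ I, γ s =
            firstColumn ((B : Matrix (Fin 5) (Fin 5) ℝ) *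
              NormedSpace.exp (s • frenetMatrix κ₃ κ₄))) ∧
        (HasConstantCurvatures γ I κ₃ κ₄ → IsOrbitOfOneParameterSubgroup γ I)) ∧
    -- each pair of curvatures belongs to exactly one case
    (∀ κ₃ κ₄ : ℝ, ∃! T : CurveType, T.Condition κ₃ κ₄) ∧
    -- normal forms
    (∀ κ₃ κ₄ : ℝ, CurveType.I1.Condition κ₃ κ₄ → ∃ μ ν : ℝ, 0 < μ ∧ 0 < ν ∧
      quarticRoots κ₃ κ₄ =
        {(μ : ℂ) + ν * Complex.I, (μ : ℂ) - ν * Complex.I,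
          -(μ : ℂ) + ν * Complex.I, -(μ : ℂ) - ν * Complex.I} ∧
      IsNormalForm κ₃ κ₄ (curveI1' μ ν) ∧
      (μ ^ 2 ≠ 3 * ν ^ 2 → ν ^ 2 ≠ 3 * μ ^ 2 → IsNormalForm κ₃ κ₄ (curveI1 μ ν))) ∧
    (∀ κ₃ κ₄ : ℝ, CurveType.I2a.Condition κ₃ κ₄ → ∃ μ ν : ℝ, 0 < ν ∧ ν < μ ∧
      quarticRoots κ₃ κ₄ = {(μ : ℂ), -(μ : ℂ), (ν : ℂ), -(ν : ℂ)} ∧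
      IsNormalForm κ₃ κ₄ (curveI2a μ ν)) ∧
    (∀ κ₃ κ₄ : ℝ, CurveType.I2b.Condition κ₃ κ₄ → ∃ μ ν : ℝ, 0 < ν ∧ ν < μ ∧
      quarticRoots κ₃ κ₄ =
        {Complex.I * μ, -(Complex.I * μ), Complex.I * ν, -(Complex.I * ν)} ∧
      κ₃ = μ ^ 2 + ν ^ 2 ∧ κ₄ = μ ^ 4 + μ ^ 2 * ν ^ 2 + ν ^ 4 ∧
      IsNormalForm κ₃ κ₄ (curveI2b μ ν) ∧
      -- the curves lie on homogeneous Lagrangian tori, on which they follow a linear flow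
      ∀ (I : Set ℝ) (γ : ℝ → Fin 4 → ℝ), IsCurveDomain I → HasConstantCurvatures γ I κ₃ κ₄ →
        ∃ g ∈ affineSymplecticGroup,
          IsHomogeneousLagrangianTorus
            (affineAct (g : Matrix (Fin 5) (Fin 5) ℝ) '' torusOrbit μ ν) ∧
          γ '' I ⊆ affineAct (g : Matrix (Fin 5) (Fin 5) ℝ) '' torusOrbit μ ν ∧
          (∀ s ∈ I, γ s = affineAct (g : Matrix (Fin 5) (Fin 5) ℝ)
            (affineAct (torusMatrix (-(ν * s)) (μ * s)) (torusPoint μ ν))) ∧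
          (I = Set.univ →
            (∃ T > 0, Function.Periodic γ T ∧ Set.InjOn γ (Set.Ico 0 T)) ∨
            closure (Set.range γ) =
              affineAct (g : Matrix (Fin 5) (Fin 5) ℝ) '' torusOrbit μ ν)) ∧
    (∀ κ₃ κ₄ : ℝ, CurveType.I2c.Condition κ₃ κ₄ → ∃ μ ν : ℝ, 0 < μ ∧ 0 < ν ∧
      quarticRoots κ₃ κ₄ = {Complex.I * μ, -(Complex.I * μ), (ν : ℂ), -(ν : ℂ)} ∧
      IsNormalForm κ₃ κ₄ (curveI2c μ ν)) ∧
    (∀ κ₃ κ₄ : ℝ, CurveType.II1.Condition κ₃ κ₄ → ∃ μ : ℝ, 0 < μ ∧ μ = √(-κ₃) ∧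
      quarticRoots κ₃ κ₄ = {0, 0, (μ : ℂ), -(μ : ℂ)} ∧
      IsNormalForm κ₃ κ₄ (curveII1 μ)) ∧
    (∀ κ₃ κ₄ : ℝ, CurveType.II2.Condition κ₃ κ₄ → ∃ μ : ℝ, 0 < μ ∧ μ = √κ₃ ∧
      quarticRoots κ₃ κ₄ = {0, 0, Complex.I * μ, -(Complex.I * μ)} ∧
      IsNormalForm κ₃ κ₄ (curveII2 μ)) ∧
    (∀ κ₃ κ₄ : ℝ, CurveType.III1.Condition κ₃ κ₄ → ∃ μ : ℝ, 0 < μ ∧ μ = √(κ₃ / 2) ∧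
      quarticRoots κ₃ κ₄ =
        {Complex.I * μ, Complex.I * μ, -(Complex.I * μ), -(Complex.I * μ)} ∧
      IsNormalForm κ₃ κ₄ (curveIII1 μ)) ∧
    (∀ κ₃ κ₄ : ℝ, CurveType.III2.Condition κ₃ κ₄ → ∃ μ : ℝ, 0 < μ ∧ μ = √(-κ₃ / 2) ∧
      quarticRoots κ₃ κ₄ = {(μ : ℂ), (μ : ℂ), -(μ : ℂ), -(μ : ℂ)} ∧
      IsNormalForm κ₃ κ₄ (curveIII2 μ)) ∧
    (∀ κ₃ κ₄ : ℝ, CurveType.IV.Condition κ₃ κ₄ →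
      quarticRoots κ₃ κ₄ = {0, 0, 0, 0} ∧
      IsNormalForm κ₃ κ₄ curveIV) ∧
    -- the group and the one-parameter subgroup behind type I.2.b
    torusSubgroup ≤ affineSymplecticGroup ∧
    (∀ x ∈ torusSubgroup, ∀ y ∈ torusSubgroup, x * y = y * x) ∧
    (∀ H : Subgroup (GL (Fin 5) ℝ), H ≤ affineSymplecticGroup →
      (∀ x ∈ H, ∀ y ∈ H, x * y = y * x) → torusSubgroup ≤ H → H = torusSubgroup) ∧
    (∀ μ ν : ℝ, 0 < ν → ν < μ →
      torusGenerator μ ν ∈ affineSymplecticAlgebra ∧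
      ∀ s : ℝ, curveI2b μ ν s =
        affineAct (NormedSpace.exp (s • torusGenerator μ ν)) (torusPoint μ ν)) := by
  refine ⟨fun κ₃ κ₄ => ⟨frenetMatrix_mem κ₃ κ₄, frenetMatrix_charpoly κ₃ κ₄, fun I γ hI =>
    ⟨hasConstantCurvatures_iff hI κ₃ κ₄, HasConstantCurvatures.isOrbit hI⟩⟩,
    existsUnique_curveType, ?_, ?_, ?_, ?_, ?_, ?_, ?_, ?_, ?_, torusSubgroup_le,
    torusSubgroup_comm, torusSubgroup_maximal, fun μ ν hν hμ => ⟨torusGenerator_mem μ ν,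
      fun s => by rw [exp_smul_torusGenerator, curveI2b_eq hν hμ]⟩⟩ <;> intro κ₃ κ₄ h
  · obtain ⟨μ, ν, hμ, hν, h1, h2⟩ := exists_frequencies_I1 h
    have hn := curveI1'_isNormalForm hμ hν h1 h2
    refine ⟨μ, ν, hμ, hν, quarticRoots_eq (by ring) ?_ (by ring) ?_, hn,
      curveI1_isNormalForm hμ hν hn⟩
    · rw [h1]
      push_cast
      linear_combination -2 * (ν : ℂ) ^ 2 * Complex.I_sq
    · rw [h2]
      push_cast
      linear_combination ((ν : ℂ) ^ 4 * (Complex.I ^ 2 - 1) - 2 * (μ : ℂ) ^ 2 * (ν : ℂ) ^ 2) *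
        Complex.I_sq
  · obtain ⟨μ, ν, hν, hμ, h1, h2⟩ := exists_frequencies_I2a h
    refine ⟨μ, ν, hν, hμ, quarticRoots_eq (by ring) ?_ (by ring) ?_,
      curveI2a_isNormalForm hν hμ h1 h2⟩
    · rw [h1]
      push_cast
      ring
    · rw [h2]
      push_cast
      ring
  · obtain ⟨μ, ν, hν, hμ, h1, h2⟩ := exists_frequencies_I2b h
    have hn := curveI2b_isNormalForm hν hμ h1 h2
    refine ⟨μ, ν, hν, hμ, quarticRoots_eq (by ring) ?_ (by ring) ?_, h1,
      by rw [h1] at h2; linarith, hn, fun I γ hI hγ => ?_⟩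
    · rw [h1]
      push_cast
      linear_combination -((μ : ℂ) ^ 2 + (ν : ℂ) ^ 2) * Complex.I_sq
    · rw [h2]
      push_cast
      linear_combination (μ : ℂ) ^ 2 * (ν : ℂ) ^ 2 * (Complex.I ^ 2 - 1) * Complex.I_sq
    -- The congruence with the normal form supplies `g`; since the normal form is a linear flow on
    -- `𝕋²_{μ,ν}`, everything else is transported by `g`.
    obtain ⟨g, hg, hs⟩ := (hn I γ hI).1 hγ
    have hs' : ∀ s ∈ I, γ s = torusChart g μ ν (-(ν * s), μ * s) := fun s hsI => by
      rw [hs s hsI, curveI2b_eq hν hμ, torusChart]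
    refine ⟨g, hg, isHomogeneousLagrangianTorus hg hν hμ, ?_, hs', ?_⟩
    · rintro _ ⟨s, hsI, rfl⟩
      rw [hs' s hsI, ← range_torusChart]
      exact ⟨_, rfl⟩
    · rintro rfl
      have hγ' : γ = fun s => torusChart g μ ν (-(ν * s), μ * s) :=
        funext fun s => hs' s (Set.mem_univ s)
      rw [hγ', ← range_torusChart]
      by_cases hi : Irrational (μ / ν)
      · exact Or.inr (closure_range_of_irrational hg hν hμ hi)
      · exact Or.inl (simple_closed_of_rational hg hν hμ hi)
  · obtain ⟨μ, ν, hμ, hν, h1, h2⟩ := exists_frequencies_I2c h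
    refine ⟨μ, ν, hμ, hν, quarticRoots_eq (by ring) ?_ (by ring) ?_,
      curveI2c_isNormalForm hμ hν h1 h2⟩
    · rw [h1]
      push_cast
      linear_combination -(μ : ℂ) ^ 2 * Complex.I_sq
    · rw [h2]
      push_cast
      linear_combination (μ : ℂ) ^ 2 * (ν : ℂ) ^ 2 * Complex.I_sq
  · obtain ⟨h1, h2⟩ := h
    have hμ : 0 < √(-κ₃) := Real.sqrt_pos.2 (by linarith)
    have e : κ₃ = -√(-κ₃) ^ 2 := by rw [Real.sq_sqrt (by linarith)]; ring
    refine ⟨√(-κ₃), hμ, rfl, quarticRoots_eq (by ring) ?_ (by ring) ?_,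
      curveII1_isNormalForm hμ e h1⟩
    · rw [show (κ₃ : ℂ) = ((-√(-κ₃) ^ 2 : ℝ) : ℂ) by rw [← e]]
      push_cast
      ring
    · rw [h1]
      simp
  · obtain ⟨h1, h2⟩ := h
    have hμ : 0 < √κ₃ := Real.sqrt_pos.2 h2
    have e : κ₃ = √κ₃ ^ 2 := by rw [Real.sq_sqrt h2.le]
    refine ⟨√κ₃, hμ, rfl, quarticRoots_eq (by ring) ?_ (by ring) ?_,
      curveII2_isNormalForm hμ e h1⟩
    · have e' : (κ₃ : ℂ) = (√κ₃ : ℂ) ^ 2 := by exact_mod_cast e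
      linear_combination -(√κ₃ : ℂ) ^ 2 * Complex.I_sq - e'
    · rw [h1]
      simp
  · obtain ⟨h1, h2⟩ := h
    have hμ : 0 < √(κ₃ / 2) := Real.sqrt_pos.2 (by linarith)
    have e : κ₃ = 2 * √(κ₃ / 2) ^ 2 := by rw [Real.sq_sqrt (by linarith)]; ring
    refine ⟨√(κ₃ / 2), hμ, rfl, quarticRoots_eq (by ring) ?_ (by ring) ?_,
      curveIII1_isNormalForm hμ e h1⟩
    · have e' : (κ₃ : ℂ) = 2 * (√(κ₃ / 2) : ℂ) ^ 2 := by exact_mod_cast e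
      linear_combination -2 * (√(κ₃ / 2) : ℂ) ^ 2 * Complex.I_sq - e'
    · have e' : (κ₃ ^ 2 - κ₄ : ℝ) = √(κ₃ / 2) ^ 4 := by
        generalize √(κ₃ / 2) = μ at *
        rw [e] at h1 ⊢
        linear_combination -1 / 4 * h1
      rw [e']
      push_cast
      linear_combination (√(κ₃ / 2) : ℂ) ^ 4 * (Complex.I ^ 2 - 1) * Complex.I_sq
  · obtain ⟨h1, h2⟩ := h
    have hμ : 0 < √(-κ₃ / 2) := Real.sqrt_pos.2 (by linarith)
    have e : κ₃ = -(2 * √(-κ₃ / 2) ^ 2) := by rw [Real.sq_sqrt (by linarith)]; ring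
    refine ⟨√(-κ₃ / 2), hμ, rfl, quarticRoots_eq (by ring) ?_ (by ring) ?_,
      curveIII2_isNormalForm hμ e h1⟩
    · have e' : (κ₃ : ℂ) = -(2 * (√(-κ₃ / 2) : ℂ) ^ 2) := by exact_mod_cast e
      linear_combination -e'
    · have e' : (κ₃ ^ 2 - κ₄ : ℝ) = √(-κ₃ / 2) ^ 4 := by
        generalize √(-κ₃ / 2) = μ at *
        rw [e] at h1 ⊢
        linear_combination -1 / 4 * h1
      rw [e']
      push_cast
      ring
  · obtain ⟨rfl, rfl⟩ := h
    exact ⟨quarticRoots_eq (by ring) (by simp) (by ring) (by simp), curveIV_isNormalForm⟩
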